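/- For $\tau$ in the upper half-plane $\mathfrak H$ let $E_4(\tau)=1+240\sum_{k\ge 1}\sigma_3(k)e^{2\pi i k\tau}$ and let $\{h,\tau\}=\left(\frac{h''}{h'}\right)'-\frac12\left(\frac{h''}{h'}\right)^2$ be the Schwarz derivative. Let $m\in\{2,3,4,5\}$, let $\Gamma(m)\subset \mathrm{SL}_2(\mathbb Z)$ be the principal congruence subgroup of level $m$, and let $n\ge 1$ be an integer. Let $h$ be a modular function for $\Gamma(m)$ (a meromorphic $\Gamma(m)$-invariant function on $\mathfrak H$ that is meromorphic at all cusps) which satisfies $$\{h,\tau\}=2\pi^2\left(\frac nm\right)^2E_4(\tau)$$ and has no pole at the cusp $\infty$. Then $h$ has only finitely many poles modulo $\Gamma(m)$. Let $a$ be the number of $\Gamma(m)$-inequivalent poles of $h$ in $\mathfrak H$, and let $b$ be the number of $\Gamma(m)$-inequivalent cusps, other than $\infty$, at which $h$ has a pole (both counted without multiplicity). Then: - if $m=2$, then $(a,b)\in\left\{\left(\frac{3n-1}{2},0\right),\left(\frac{n-1}{2},1\right)\right\}$; - if $m=3$, then $(a,b)\in\{(2n-1,0),(n-1,1)\}$;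 - if $m=4$, then $(a,b)\in\{(3n-2,0),(2n-2,1),(n-2,2)\}$; - if $m=5$, then $(a,b)=(n(6-k)-5,k)$ for some integer $0\le k\le 5$. -/

import Mathlib

open UpperHalfPlane MatrixGroups

namespace ModularSchwarz

/-- The Schwarz derivative `{f, z} = (f''/f')' - (1/2) (f''/f')^2`. -/
noncomputable def schwarzDeriv (f : ℂ → ℂ) (z : ℂ) : ℂ :=
  deriv (fun w ↦ deriv (deriv f) w / deriv f w) z - 1 / 2 * (deriv (deriv f) z / deriv f z) ^ 2

/-- The expansion of a function `h` on the upper half-plane at the cusp `γ ∞`, for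
`γ ∈ SL(2, ℤ)`: the function `F` of the local parameter `q = exp (2 π i τ / m)` near `q = 0`
with `h (γ τ) = F q`. (It is meaningful when `τ ↦ h (γ τ)` is `m`-periodic, which holds if
`h` is invariant under the principal congruence subgroup `Γ(m)`. Its value at `q = 0` is
irrelevant below: only `MeromorphicAt` and `meromorphicOrderAt` are used.) -/
noncomputable def cuspExpansion (m : ℕ) (h : ℍ → ℂ) (γ : SL(2, ℤ)) : ℂ → ℂ :=
  UpperHalfPlane.cuspFunction m (fun τ ↦ h (γ • τ))

/-- A modular function for the principal congruence subgroup `Γ(m)`: a meromorphic function on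
the upper half-plane which is invariant under `Γ(m)` and meromorphic at all the cusps.

A meromorphic function is represented by its unique normal form: it is analytic away from its
poles and takes the conventional value `0` at its poles. -/
structure IsModularFunction (m : ℕ) (h : ℍ → ℂ) : Prop where
  meromorphic : MeromorphicNFOn (h ∘ ofComplex) {z : ℂ | 0 < z.im}
  invariant : ∀ γ ∈ CongruenceSubgroup.Gamma m, ∀ τ : ℍ, h (γ • τ) = h τ
  meromorphic_cusps : ∀ γ : SL(2, ℤ), MeromorphicAt (cuspExpansion m h γ) 0

/-- `h` solves `{h, τ} = 2 π² (n/m)² E₄(τ)`, as an identity of meromorphic functions on the upper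
half-plane, that is, at all points outside a discrete closed subset of it. -/
def IsSchwarzSolution (m n : ℕ) (h : ℍ → ℂ) : Prop :=
  schwarzDeriv (h ∘ ofComplex) =ᶠ[Filter.codiscreteWithin {z : ℂ | 0 < z.im}]
    fun z ↦ 2 * (Real.pi : ℂ) ^ 2 * ((n : ℂ) / (m : ℂ)) ^ 2 * ModularForm.E₄ (ofComplex z)

/-- `h` has a pole at the point `τ` of the upper half-plane. -/
def HasPoleAt (h : ℍ → ℂ) (τ : ℍ) : Prop :=
  meromorphicOrderAt (h ∘ ofComplex) (τ : ℂ) < 0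

/-- `h` has a pole at the cusp `c`. -/
def HasPoleAtCusp (m : ℕ) (h : ℍ → ℂ) (c : OnePoint ℝ) : Prop :=
  ∃ γ : SL(2, ℤ), Matrix.SpecialLinearGroup.mapGL ℝ γ • (OnePoint.infty : OnePoint ℝ) = c ∧
    meromorphicOrderAt (cuspExpansion m h γ) 0 < 0

/-- The set of poles of `h` in `Γ(m) \ ℍ`. -/
def interiorPoles (m : ℕ) (h : ℍ → ℂ) :
    Set (MulAction.orbitRel.Quotient (CongruenceSubgroup.Gamma m) ℍ) :=
  {p | ∃ τ : ℍ, HasPoleAt h τ ∧ p = Quotient.mk _ τ}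

/-- The set of inequivalent cusps of `Γ(m)`, other than the class of `∞`, at which `h` has
a pole. -/
def cuspPoles (m : ℕ) (h : ℍ → ℂ) :
    Set (CuspOrbits (CongruenceSubgroup.Gamma m : Subgroup (GL (Fin 2) ℝ))) :=
  {p | ∃ c : cuspsSubMulAction (CongruenceSubgroup.Gamma m : Subgroup (GL (Fin 2) ℝ)),
    p = Quotient.mk _ c ∧ HasPoleAtCusp m h c ∧
    ∀ g ∈ (CongruenceSubgroup.Gamma m : Subgroup (GL (Fin 2) ℝ)),
      g • (OnePoint.infty : OnePoint ℝ) ≠ c}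

end ModularSchwarz

namespace ModularSchwarz
open Filter Topology Manifold

/-! ### Generalities on the upper half-plane -/

/-! The Schwarzian equation determines all orders of `h'`. At a point of the upper half-plane the
right side is holomorphic, so if `h'` has order `l` there, the leading coefficient gives `l (l + 2)
= 0`: order `-2` at a pole of `h`, `0` elsewhere (`order_deriv_of_schwarzDeriv`). The Schwarzian and
`E₄` both have weight 4, so every translate of `h` by `SL(2, ℤ)` solves the same equation
(`eventually_schwarzDeriv_translate`). At a cusp `E₄ → 1`, and comparing constant terms shows that
the derivative of the translate behaves like `q ^ (±n)`, where `q = exp (2πiτ/m)` and the sign is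
negative exactly at a pole (`exists_cusp_asymptotics`).

Counting zeros and poles then gives one linear relation. To stay at level one, take the product of
`D_x ^ 6 / Δ` over `x` in `SL(2, ℤ) / Γ(m)`, with `D_x` the derivative of the translate of `h` by
`x`. It is `SL(2, ℤ)`-invariant, and its poles are cancelled by powers of `j - j(q)`, `q` running
over the poles of `h`. The result has neither zeros nor poles in the upper half-plane, so it or its
inverse is essentially a level-one modular form of weight 0, a constant, and its exponent at `i∞`
vanishes (`exponent_eq_zero`). This is `valence_formula`; with the orders of the finite groups
involved it reads `2a = 3n - 1 - 2nb` for `m = 2` and `a = n(B - b) - c` with `(B, c) = (2, 1), (3,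
2), (6, 5)` for `m = 3, 4, 5`. Since `a ≥ 0`, only the listed values of `b` remain.

The cancellation requires the order of `j - j(p)` at `p` to be half the order of the stabilizer of
`p` (`exists_order_jInv`). That follows from `j` separating orbits (`exists_smul_eq_of_jInv_eq`),
proved by a connectedness argument in the plane of values. -/

lemma analyticAt_of_mdiff {f : ℍ → ℂ} (hf : MDiff f) {z : ℂ} (hz : 0 < z.im) :
    AnalyticAt ℂ (f ∘ ofComplex) z :=
  (UpperHalfPlane.mdifferentiable_iff.mp hf).analyticAt (isOpen_upperHalfPlaneSet.mem_nhds hz)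

lemma exists_injOn_of_deriv_ne_zero {f : ℂ → ℂ} {z : ℂ} (hf : AnalyticAt ℂ f z)
    (h : deriv f z ≠ 0) : ∃ U ∈ 𝓝 z, Set.InjOn f U := by
  have h1 := hf.hasStrictDerivAt.hasStrictFDerivAt_equiv h
  exact ⟨(h1.toOpenPartialHomeomorph f).source,
    (h1.toOpenPartialHomeomorph f).open_source.mem_nhds h1.mem_toOpenPartialHomeomorph_source,
    (h1.toOpenPartialHomeomorph f).injOn⟩

lemma continuous_SL_smul (γ : SL(2, ℤ)) : Continuous (fun τ : ℍ ↦ γ • τ) :=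
  continuous_const_smul (Matrix.SpecialLinearGroup.mapGL ℝ γ)

lemma finite_setOf_smul_inter {K L : Set ℍ} (hK : IsCompact K) (hL : IsCompact L) :
    {γ : SL(2, ℤ) | ∃ z ∈ K, γ • z ∈ L}.Finite := by
  have h := ProperlyDiscontinuousSMul.finite_disjoint_inter_image (Γ := 𝒮ℒ) hK hL
  have hinj : Function.Injective (Matrix.SpecialLinearGroup.mapGL ℝ : SL(2, ℤ) →* GL (Fin 2) ℝ) :=
    Matrix.SpecialLinearGroup.mapGL_injective
  refine Set.Finite.of_finite_image (f := fun γ ↦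
    (⟨Matrix.SpecialLinearGroup.mapGL ℝ γ, ⟨γ, rfl⟩⟩ : 𝒮ℒ)) (h.subset ?_) ?_
  · rintro _ ⟨γ, ⟨z, hz, hγ⟩, rfl⟩
    exact ⟨γ • z, ⟨z, hz, rfl⟩, hγ⟩
  · intro a _ b _ hab
    exact hinj (congrArg Subtype.val hab)

/-- By proper discontinuity only finitely many `γ` matter near `(p, p')`, and each one with `γ • p ≠
p'` is excluded by continuity on a smaller neighbourhood. -/
lemma eventually_forall_smul_eq (p p' : ℍ) :
    ∀ᶠ zw : ℍ × ℍ in 𝓝 p ×ˢ 𝓝 p', ∀ γ : SL(2, ℤ), γ • zw.1 = zw.2 → γ • p = p' := by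
  obtain ⟨K, hK, hKp⟩ := exists_compact_mem_nhds p
  obtain ⟨L, hL, hLp⟩ := exists_compact_mem_nhds p'
  have hfin := finite_setOf_smul_inter hK hL
  have h1 : ∀ᶠ zw : ℍ × ℍ in 𝓝 p ×ˢ 𝓝 p', ∀ γ ∈ {γ : SL(2, ℤ) | ∃ z ∈ K, γ • z ∈ L},
      γ • zw.1 = zw.2 → γ • p = p' := by
    refine (Filter.eventually_all_finite hfin).mpr fun γ _ ↦ ?_
    by_cases hγ : γ • p = p'
    · exact .of_forall fun _ _ ↦ hγ
    have h2 : Tendsto (fun zw : ℍ × ℍ ↦ (γ • zw.1, zw.2)) (𝓝 p ×ˢ 𝓝 p') (𝓝 (γ • p, p')) := by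
      rw [nhds_prod_eq]
      exact (((continuous_SL_smul γ).tendsto p).comp tendsto_fst).prodMk tendsto_snd
    filter_upwards [h2.eventually ((isOpen_ne_fun continuous_fst continuous_snd).mem_nhds hγ : {x : ℍ × ℍ | x.1 ≠ x.2} ∈ _)]
      with zw h h'
    exact absurd h' h
  filter_upwards [h1, prod_mem_prod hKp hLp] with zw h h' γ hγ
  exact h γ ⟨zw.1, h'.1, hγ ▸ h'.2⟩ hγ

/-! ### The modular invariant -/

/-- The modular invariant `E₄ ^ 3 / Δ`. -/
noncomputable def jInv (τ : ℍ) : ℂ := ModularForm.E₄ τ ^ 3 / ModularForm.discriminant τ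

lemma E₄_smul (γ : SL(2, ℤ)) (τ : ℍ) :
    ModularForm.E₄ (γ • τ) = denom γ τ ^ 4 * ModularForm.E₄ τ :=
  SlashInvariantForm.slash_action_eqn'' ModularForm.E₄
    (MonoidHom.mem_range.mpr ⟨γ, rfl⟩) τ

lemma discriminant_smul (γ : SL(2, ℤ)) (τ : ℍ) :
    ModularForm.discriminant (γ • τ) = denom γ τ ^ 12 * ModularForm.discriminant τ :=
  SlashInvariantForm.slash_action_eqn'' CuspForm.discriminant
    (MonoidHom.mem_range.mpr ⟨γ, rfl⟩) τ

lemma jInv_smul (γ : SL(2, ℤ)) (τ : ℍ) : jInv (γ • τ) = jInv τ := by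
  have h := denom_ne_zero γ τ
  have h' := ModularForm.discriminant_ne_zero τ
  rw [jInv, jInv, E₄_smul, discriminant_smul]
  field_simp

lemma mdiff_E₄ : MDiff (ModularForm.E₄ : ℍ → ℂ) := ModularFormClass.holo ModularForm.E₄

lemma mdiff_discriminant : MDiff ModularForm.discriminant :=
  CuspFormClass.holo CuspForm.discriminant

lemma analyticAt_discriminant {z : ℂ} (hz : 0 < z.im) :
    AnalyticAt ℂ (ModularForm.discriminant ∘ ofComplex) z :=
  analyticAt_of_mdiff mdiff_discriminant hz

lemma analyticAt_jInv {z : ℂ} (hz : 0 < z.im) : AnalyticAt ℂ (jInv ∘ ofComplex) z :=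
  ((analyticAt_of_mdiff mdiff_E₄ hz).pow 3).div (analyticAt_discriminant hz)
    (ModularForm.discriminant_ne_zero _)

lemma continuous_jInv : Continuous jInv := by
  refine continuous_iff_continuousAt.mpr fun τ ↦ ?_
  have := (analyticAt_jInv τ.im_pos).continuousAt.comp (continuous_coe.continuousAt (x := τ))
  simpa [Function.comp_def] using this

lemma tendsto_E₄_atImInfty : Tendsto (ModularForm.E₄ : ℍ → ℂ) atImInfty (𝓝 1) := by
  have han := ModularFormClass.analyticAt_cuspFunction_zero ModularForm.E₄ one_pos
    one_mem_strictPeriods_SL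
  have h0 : cuspFunction 1 ModularForm.E₄ 0 = 1 := by
    have := EisensteinSeries.E_qExpansion_coeff_zero (k := 4) (by norm_num) ⟨2, rfl⟩
    rw [qExpansion_coeff] at this
    simpa using this
  have h := (h0 ▸ han.continuousAt.tendsto).comp (qParam_tendsto_atImInfty one_pos)
  refine h.congr fun τ ↦ ?_
  exact SlashInvariantFormClass.eq_cuspFunction ModularForm.E₄ τ one_mem_strictPeriods_SL one_ne_zero

lemma tendsto_discriminant_div_qParam :
    Tendsto (fun τ : ℍ ↦ ModularForm.discriminant τ / Function.Periodic.qParam 1 τ)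
      atImInfty (𝓝 1) := by
  refine (ModularForm.tendsto_atImInfty_tprod_one_sub_eta_q_pow).congr fun τ ↦ ?_
  rw [ModularForm.discriminant_eq_q_prod, mul_div_cancel_left₀ _ (Function.Periodic.qParam_ne_zero _)]

lemma tendsto_jInv_mul_qParam :
    Tendsto (fun τ : ℍ ↦ jInv τ * Function.Periodic.qParam 1 τ) atImInfty (𝓝 1) := by
  have := (tendsto_E₄_atImInfty.pow 3).div tendsto_discriminant_div_qParam one_ne_zero
  simp only [one_pow, div_one] at this
  refine this.congr fun τ ↦ ?_
  have := ModularForm.discriminant_ne_zero τ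
  simp only [jInv, Pi.div_apply]
  field_simp

/-- Two points close to the cusp at which `jInv` takes the same value differ by a translation. -/
lemma exists_forall_jInv_eq : ∃ Y : ℝ, ∀ τ τ' : ℍ, Y ≤ τ.im → Y ≤ τ'.im → jInv τ = jInv τ' →
    ∃ γ : SL(2, ℤ), γ • τ = τ' := by
  set D := cuspFunction 1 ModularForm.discriminant with hD
  set E := cuspFunction 1 ModularForm.E₄ with hE
  have hDa : AnalyticAt ℂ D 0 := ModularFormClass.analyticAt_cuspFunction_zero
    CuspForm.discriminant one_pos one_mem_strictPeriods_SL
  have hEa : AnalyticAt ℂ E 0 := ModularFormClass.analyticAt_cuspFunction_zero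
    ModularForm.E₄ one_pos one_mem_strictPeriods_SL
  have hE0 : E 0 = 1 := by
    have := EisensteinSeries.E_qExpansion_coeff_zero (k := 4) (by norm_num) ⟨2, rfl⟩
    rw [qExpansion_coeff] at this
    simpa using this
  have hD0 : D 0 = 0 := by
    rw [hD, ModularForm.discriminant_cuspFunction_eqOn (Metric.mem_ball_self one_pos)]
    simp
  have hD1 : deriv D 0 = 1 := by
    have := ModularForm.discriminant_qExpansion_coeff_one
    rw [qExpansion_coeff] at this
    simpa using this
  -- `D / E ^ 3` expresses `1 / jInv` through `q`; its derivative at `0` is `1`, so it is injective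
  -- near `q = 0`.
  have hFa : AnalyticAt ℂ (fun q ↦ D q / E q ^ 3) 0 :=
    hDa.div (hEa.pow 3) (by simp [hE0])
  have hF1 : deriv (fun q ↦ D q / E q ^ 3) 0 ≠ 0 := by
    have := (hDa.differentiableAt.hasDerivAt.div (hEa.differentiableAt.hasDerivAt.pow 3)
      (by simp [hE0])).deriv
    have h2 : deriv (fun q ↦ D q / E q ^ 3) 0 = 1 := by
      refine this.trans ?_
      simp [hE0, hD0, hD1]
    simp [h2]
  obtain ⟨U, hU, hinj⟩ := exists_injOn_of_deriv_ne_zero hFa hF1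
  have hev := (qParam_tendsto_atImInfty one_pos).eventually_mem hU
  obtain ⟨Y, hY⟩ := (atImInfty_mem _).mp hev
  refine ⟨Y, fun τ τ' hτ hτ' h ↦ ?_⟩
  have key : ∀ τ : ℍ, (fun q ↦ D q / E q ^ 3) (Function.Periodic.qParam 1 τ) = (jInv τ)⁻¹ := by
    intro τ
    have h1 : D (Function.Periodic.qParam 1 τ) = ModularForm.discriminant τ :=
      SlashInvariantFormClass.eq_cuspFunction CuspForm.discriminant τ one_mem_strictPeriods_SL
        one_ne_zero
    have h2 : E (Function.Periodic.qParam 1 τ) = ModularForm.E₄ τ :=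
      SlashInvariantFormClass.eq_cuspFunction ModularForm.E₄ τ one_mem_strictPeriods_SL one_ne_zero
    simp [h1, h2, jInv]
  have hq := hinj (hY τ hτ) (hY τ' hτ') (by rw [key, key, h])
  obtain ⟨a, ha⟩ := Function.Periodic.qParam_left_inv_mod_period one_ne_zero (τ : ℂ)
  obtain ⟨b, hb⟩ := Function.Periodic.qParam_left_inv_mod_period one_ne_zero (τ' : ℂ)
  refine ⟨ModularGroup.T ^ (a - b), ?_⟩
  ext
  rw [ModularGroup.coe_T_zpow_smul_eq]
  rw [hq, hb] at ha
  push_cast at ha ⊢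
  linear_combination -ha

/-- By the identity theorem `jInv` would be constant everywhere, and then `jInv * q` would tend to
`0` at `i∞` instead of `1`. -/
lemma not_eventually_const_jInv (τ : ℍ) :
    ¬ ∀ᶠ z in 𝓝 (τ : ℂ), (jInv ∘ ofComplex) z = (jInv ∘ ofComplex) τ := by
  intro h
  have han : AnalyticOnNhd ℂ (jInv ∘ ofComplex) {z : ℂ | 0 < z.im} := fun z hz ↦ analyticAt_jInv hz
  have hconst := han.eqOn_of_preconnected_of_eventuallyEq (analyticOnNhd_const)
    (convex_halfSpace_im_gt 0).isPreconnected τ.im_pos h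
  have h1 : ∀ τ' : ℍ, jInv τ' = jInv τ := fun τ' ↦ by simpa using hconst τ'.im_pos
  have h2 := tendsto_jInv_mul_qParam
  simp_rw [h1] at h2
  have h3 := (qParam_tendsto_atImInfty one_pos).const_mul (jInv τ)
  simp only [mul_zero] at h3
  exact one_ne_zero (tendsto_nhds_unique h2 h3)

lemma nhds_le_map_jInv (τ : ℍ) : 𝓝 (jInv τ) ≤ map jInv (𝓝 τ) := by
  have h := ((analyticAt_jInv τ.im_pos).eventually_constant_or_nhds_le_map_nhds).resolve_left
    (not_eventually_const_jInv τ)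
  rw [← isOpenEmbedding_coe.map_nhds_eq] at h
  simpa [Filter.map_map, Function.comp_def] using h

end ModularSchwarz

namespace ModularSchwarz
open Filter Topology Manifold

/-! ### The modular invariant separates orbits -/

lemma countable_critical_points_jInv :
    {τ : ℍ | deriv (jInv ∘ ofComplex) τ = 0}.Countable := by
  have key : ∀ τ : ℍ, {z : ℍ | z ≠ τ → deriv (jInv ∘ ofComplex) z ≠ 0} ∈ 𝓝 τ := by
    intro τ
    have han := (analyticAt_jInv τ.im_pos).deriv
    have h : ∀ᶠ z in 𝓝[≠] (τ : ℂ), deriv (jInv ∘ ofComplex) z ≠ 0 := by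
      refine han.eventually_eq_zero_or_eventually_ne_zero.resolve_left fun h ↦ ?_
      refine not_eventually_const_jInv τ ?_
      have hd : ∀ᶠ z in 𝓝 (τ : ℂ), DifferentiableAt ℂ (jInv ∘ ofComplex) z :=
        (analyticAt_jInv τ.im_pos).eventually_analyticAt.mono fun z hz ↦ hz.differentiableAt
      obtain ⟨r, hr, hball⟩ := Metric.eventually_nhds_iff_ball.mp (h.and hd)
      filter_upwards [Metric.ball_mem_nhds (τ : ℂ) hr] with z hz
      exact Metric.isOpen_ball.is_const_of_deriv_eq_zero (convex_ball _ _).isPreconnected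
        (fun w hw ↦ (hball w hw).2.differentiableWithinAt) (fun w hw ↦ (hball w hw).1) hz
        (Metric.mem_ball_self hr)
    rw [eventually_nhdsWithin_iff] at h
    filter_upwards [(continuous_coe.tendsto τ).eventually h] with z hz hne
    exact hz (fun h' ↦ hne (UpperHalfPlane.ext h'))
  obtain ⟨t, ht, hcov⟩ := countable_cover_nhds key
  refine ht.mono fun τ hτ ↦ ?_
  obtain ⟨x, hx, hτx⟩ : ∃ x ∈ t, τ ∈ {z : ℍ | z ≠ x → deriv (jInv ∘ ofComplex) z ≠ 0} := by
    simpa using (Set.ext_iff.mp hcov τ).mpr trivial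
  by_cases h : τ = x
  · exact h ▸ hx
  · exact absurd hτ (hτx h)

lemma tendsto_jInv_cobounded : Tendsto jInv atImInfty (Bornology.cobounded ℂ) := by
  have h0 : Tendsto (fun τ : ℍ ↦ (jInv τ)⁻¹) atImInfty (𝓝 0) := by
    have := (qParam_tendsto_atImInfty one_pos).div tendsto_jInv_mul_qParam one_ne_zero
    simp only [zero_div] at this
    refine this.congr fun τ ↦ ?_
    have h1 := Function.Periodic.qParam_ne_zero (h := 1) (τ : ℂ)
    simp only [Pi.div_apply]
    by_cases h2 : jInv τ = 0
    · simp [h2]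
    · field_simp
  have hne : ∀ᶠ τ : ℍ in atImInfty, (jInv τ)⁻¹ ≠ 0 := by
    filter_upwards [tendsto_jInv_mul_qParam.eventually_ne one_ne_zero] with τ hτ
    exact inv_ne_zero (left_ne_zero_of_mul hτ)
  have := (tendsto_inv₀_nhdsNE_zero (α := ℂ)).comp (tendsto_nhdsWithin_iff.mpr ⟨h0, hne⟩)
  simpa [Function.comp_def] using this

lemma exists_forall_norm_jInv_le (C : ℝ) : ∃ Y : ℝ, ∀ τ : ℍ, ‖jInv τ‖ ≤ C → τ.im ≤ Y := by
  have h := (tendsto_norm_atTop_iff_cobounded.mpr tendsto_jInv_cobounded).eventually_gt_atTop C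
  obtain ⟨Y, hY⟩ := (atImInfty_mem _).mp h
  exact ⟨Y, fun τ hτ ↦ le_of_not_ge fun h' ↦ absurd (hY τ h') (not_lt.mpr hτ)⟩

/-- The set of values which `jInv` takes at two inequivalent points. -/
def multipleValues : Set ℂ :=
  {c | ∃ p p' : ℍ, jInv p = c ∧ jInv p' = c ∧ ∀ γ : SL(2, ℤ), γ • p ≠ p'}

/-- `jInv` is an open map, and points close to two inequivalent points are still inequivalent. -/
lemma isOpen_multipleValues : IsOpen multipleValues := by
  refine isOpen_iff_mem_nhds.mpr ?_
  rintro c ⟨p, p', hp, hp', hne⟩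
  have hev : ∀ᶠ zw : ℍ × ℍ in 𝓝 p ×ˢ 𝓝 p', ∀ γ : SL(2, ℤ), γ • zw.1 ≠ zw.2 := by
    filter_upwards [eventually_forall_smul_eq p p'] with zw h γ hγ
    exact hne γ (h γ hγ)
  obtain ⟨V, hV, V', hV', hVV'⟩ := mem_prod_iff.mp hev
  have h1 : jInv '' V ∈ 𝓝 c := hp ▸ nhds_le_map_jInv p (image_mem_map hV)
  have h2 : jInv '' V' ∈ 𝓝 c := hp' ▸ nhds_le_map_jInv p' (image_mem_map hV')
  filter_upwards [h1, h2]
  rintro _ ⟨z, hz, rfl⟩ ⟨w, hw, hzw⟩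
  exact ⟨z, w, rfl, hzw, hVV' (Set.mk_mem_prod hz hw)⟩

lemma exists_mem_truncatedFundamentalDomain {C : ℝ} : ∃ Y : ℝ, ∀ τ : ℍ, ‖jInv τ‖ ≤ C →
    ∃ γ : SL(2, ℤ), γ • τ ∈ ModularGroup.truncatedFundamentalDomain Y := by
  obtain ⟨Y, hY⟩ := exists_forall_norm_jInv_le C
  refine ⟨Y, fun τ hτ ↦ ?_⟩
  obtain ⟨γ, hγ⟩ := ModularGroup.exists_smul_mem_fd τ
  exact ⟨γ, hγ, hY _ (by rwa [jInv_smul])⟩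

/-- Bounded values are taken in a compact truncated fundamental domain, so the two inequivalent
sequences can be moved there and have limits `z`, `w` over `c`. If `z`, `w` were equivalent, local
injectivity of `jInv` at the noncritical point `w` would make late terms of the sequences
equivalent. -/
lemma mem_multipleValues_of_mem_closure {c : ℂ} (hc : c ∈ closure multipleValues)
    (hcrit : ∀ τ : ℍ, jInv τ = c → deriv (jInv ∘ ofComplex) τ ≠ 0) : c ∈ multipleValues := by
  obtain ⟨u, hu, hlim⟩ := mem_closure_iff_seq_limit.mp hc
  choose p p' hp hp' hne using hu
  obtain ⟨C, hC⟩ := hlim.norm.bddAbove_range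
  obtain ⟨Y, hY⟩ := exists_mem_truncatedFundamentalDomain (C := C)
  have hb : ∀ k, ‖u k‖ ≤ C := fun k ↦ hC ⟨k, rfl⟩
  choose g hg using fun k ↦ hY (p k) (by rw [hp]; exact hb k)
  choose g' hg' using fun k ↦ hY (p' k) (by rw [hp']; exact hb k)
  have hK := ModularGroup.isCompact_truncatedFundamentalDomain Y
  obtain ⟨⟨z, w⟩, -, φ, hφ, hzw⟩ := (hK.prod hK).tendsto_subseq
    (fun k ↦ Set.mk_mem_prod (hg k) (hg' k))
  have hz : Tendsto (fun k ↦ g (φ k) • p (φ k)) atTop (𝓝 z) := (continuous_fst.tendsto _).comp hzw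
  have hw : Tendsto (fun k ↦ g' (φ k) • p' (φ k)) atTop (𝓝 w) := (continuous_snd.tendsto _).comp hzw
  have hjz : jInv z = c := by
    refine tendsto_nhds_unique ((continuous_jInv.tendsto z).comp hz) ?_
    simpa only [Function.comp_def, jInv_smul, hp] using hlim.comp hφ.tendsto_atTop
  have hjw : jInv w = c := by
    refine tendsto_nhds_unique ((continuous_jInv.tendsto w).comp hw) ?_
    simpa only [Function.comp_def, jInv_smul, hp'] using hlim.comp hφ.tendsto_atTop
  refine ⟨z, w, hjz, hjw, fun γ hγ ↦ ?_⟩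
  obtain ⟨U, hU, hinj⟩ := exists_injOn_of_deriv_ne_zero (analyticAt_jInv w.im_pos) (hcrit w hjw)
  have hU' := continuous_coe.continuousAt.preimage_mem_nhds hU
  have h1 : Tendsto (fun k ↦ γ • (g (φ k) • p (φ k))) atTop (𝓝 w) :=
    hγ ▸ ((continuous_SL_smul γ).tendsto z).comp hz
  obtain ⟨k, hk1, hk2⟩ := ((h1.eventually_mem hU').and (hw.eventually_mem hU')).exists
  have h2 := hinj hk1 hk2 (by simp only [Function.comp_apply, ofComplex_apply, jInv_smul, hp, hp'])
  refine hne (φ k) ((g' (φ k))⁻¹ * γ * g (φ k)) ?_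
  rw [mul_smul, mul_smul, UpperHalfPlane.ext h2, inv_smul_smul]

/-- Near the cusp equal values force equivalence, and the rest of the fundamental domain is compact.
-/
lemma exists_forall_mem_multipleValues_norm_le : ∃ R : ℝ, ∀ c ∈ multipleValues, ‖c‖ ≤ R := by
  obtain ⟨Y, hY⟩ := exists_forall_jInv_eq
  have hK := ModularGroup.isCompact_truncatedFundamentalDomain Y
  obtain ⟨R, hR⟩ := (hK.image continuous_jInv).isBounded.exists_norm_le
  refine ⟨R, ?_⟩
  rintro c ⟨p, p', hp, hp', hne⟩
  by_contra! hlt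
  have key : ∀ τ : ℍ, jInv τ = c → ∃ γ : SL(2, ℤ), Y ≤ (γ • τ).im := by
    intro τ hτ
    obtain ⟨γ, hγ⟩ := ModularGroup.exists_smul_mem_fd τ
    refine ⟨γ, le_of_not_ge fun h ↦ absurd (hR _ ⟨γ • τ, ⟨hγ, h⟩, rfl⟩) ?_⟩
    rw [jInv_smul, hτ]
    exact not_le.mpr hlt
  obtain ⟨γ, hγ⟩ := key p hp
  obtain ⟨γ', hγ'⟩ := key p' hp'
  obtain ⟨g, hg⟩ := hY _ _ hγ hγ' (by rw [jInv_smul, jInv_smul, hp, hp'])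
  refine hne (γ'⁻¹ * g * γ) ?_
  rw [mul_smul, mul_smul, hg, inv_smul_smul]

/-- The plane minus the countable set of critical values is connected and dense, and within it
`multipleValues` is open and closed. If nonempty, it would contain this whole complement, which is
unbounded. -/
lemma multipleValues_eq_empty : multipleValues = ∅ := by
  set B : Set ℂ := jInv '' {τ : ℍ | deriv (jInv ∘ ofComplex) τ = 0} with hB
  have hBc : B.Countable := countable_critical_points_jInv.image _
  have hconn : IsPreconnected Bᶜ :=
    (hBc.isConnected_compl_of_one_lt_rank (by simp)).isPreconnected
  have hdense : Dense Bᶜ := hBc.dense_compl ℝ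
  by_contra hne
  have hne' := hdense.inter_open_nonempty _ isOpen_multipleValues
    (Set.nonempty_iff_ne_empty.mpr hne)
  have hsub := hconn.subset_of_closure_inter_subset isOpen_multipleValues
    (by rwa [Set.inter_comm]) fun c ⟨hc, hcB⟩ ↦ mem_multipleValues_of_mem_closure hc
      fun τ hτ h0 ↦ hcB ⟨τ, h0, hτ⟩
  obtain ⟨R, hR⟩ := exists_forall_mem_multipleValues_norm_le
  obtain ⟨c, hc, hcB⟩ := hdense.inter_open_nonempty {c : ℂ | R < ‖c‖}
    (isOpen_lt continuous_const continuous_norm)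
    ⟨((|R| + 1 : ℝ) : ℂ), by
      simp only [Set.mem_ofPred_eq, Complex.norm_real, Real.norm_eq_abs]
      exact (le_abs_self R).trans_lt ((lt_add_one _).trans_le (le_abs_self _))⟩
  exact absurd (hR c (hsub hcB)) (not_le.mpr hc)

/-- The modular invariant separates the orbits of the modular group. -/
theorem exists_smul_eq_of_jInv_eq {p p' : ℍ} (h : jInv p = jInv p') :
    ∃ γ : SL(2, ℤ), γ • p = p' := by
  by_contra! hne
  have : jInv p ∈ multipleValues := ⟨p, p', rfl, h.symm, hne⟩
  simp [multipleValues_eq_empty] at this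

end ModularSchwarz

namespace ModularSchwarz
open Filter Topology Manifold

/-! ### Local structure of analytic functions -/

/-- A `k`-th root of the nonvanishing factor in `f - f p = (z - p) ^ k * g` is absorbed into the
coordinate `ψ`. -/
lemma exists_analyticAt_pow_eq {f : ℂ → ℂ} {p : ℂ} (hf : AnalyticAt ℂ f p)
    (hnc : ¬ ∀ᶠ z in 𝓝 p, f z = f p) :
    ∃ (k : ℕ) (ψ : ℂ → ℂ), k ≠ 0 ∧ AnalyticAt ℂ ψ p ∧ ψ p = 0 ∧ deriv ψ p ≠ 0 ∧
      (∀ᶠ z in 𝓝 p, f z = f p + ψ z ^ k) ∧ meromorphicOrderAt (fun z ↦ f z - f p) p = (k : ℤ) := by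
  have hF : AnalyticAt ℂ (fun z ↦ f z - f p) p := hf.sub analyticAt_const
  obtain ⟨k, g, hg, hgp, hfg⟩ := hF.exists_eventuallyEq_pow_smul_nonzero_iff.mpr
    (by simpa only [sub_eq_zero] using hnc)
  have hk : k ≠ 0 := by
    rintro rfl
    have := hfg.self_of_nhds
    simp only [sub_self, pow_zero, one_smul] at this
    exact hgp this.symm
  obtain ⟨c, hc⟩ := IsAlgClosed.exists_pow_nat_eq (g p) (Nat.pos_of_ne_zero hk)
  have hc0 : c ≠ 0 := by
    rintro rfl
    exact hgp (by rw [← hc, zero_pow hk])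
  -- After division by `g p` the value at `p` is `1`, where the principal branch of the power is
  -- analytic; `c` restores the constant.
  have hgd : AnalyticAt ℂ (fun z ↦ g z / g p) p := hg.div_const
  have hr : AnalyticAt ℂ (fun z ↦ (g z / g p) ^ ((k : ℂ)⁻¹)) p :=
    hgd.cpow analyticAt_const (by simp [div_self hgp])
  set r : ℂ → ℂ := fun z ↦ c * (g z / g p) ^ ((k : ℂ)⁻¹) with hrdef
  have hra : AnalyticAt ℂ r p := analyticAt_const.mul hr
  have hrp : r p = c := by simp [hrdef, div_self hgp]
  have hrk : ∀ z, r z ^ k = g z := by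
    intro z
    simp only [hrdef, mul_pow, hc, Complex.cpow_nat_inv_pow _ hk]
    field_simp
  refine ⟨k, fun z ↦ (z - p) * r z, hk, (analyticAt_id.sub analyticAt_const).mul hra, by simp,
    ?_, ?_, ?_⟩
  · have hd : HasDerivAt (fun z ↦ (z - p) * r z) (1 * r p + (p - p) * deriv r p) p :=
      ((hasDerivAt_id p).sub_const p).mul hra.differentiableAt.hasDerivAt
    rw [hd.deriv]
    simpa [hrp] using hc0
  · filter_upwards [hfg] with z hz
    rw [mul_pow, hrk]
    simp only [smul_eq_mul] at hz
    rw [← hz]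
    ring
  · rw [meromorphicOrderAt_eq_int_iff hF.meromorphicAt]
    exact ⟨g, hg, hgp, by simpa using hfg.filter_mono nhdsWithin_le_nhds⟩

/-- Near a point where a nonconstant analytic function takes a value with multiplicity `k`, the
nearby values are taken exactly `k` times. -/
lemma exists_card_fiber {f : ℂ → ℂ} {p : ℂ} (hf : AnalyticAt ℂ f p)
    (hnc : ¬ ∀ᶠ z in 𝓝 p, f z = f p) :
    ∃ k : ℕ, meromorphicOrderAt (fun z ↦ f z - f p) p = (k : ℤ) ∧
      (∃ V ∈ 𝓝 p, ∀ T : Finset ℂ, ↑T ⊆ V → (∀ z ∈ T, ∀ w ∈ T, f z = f w) → T.card ≤ k) ∧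
      ∀ V ∈ 𝓝 p, ∃ T : Finset ℂ, ↑T ⊆ V ∧ p ∉ T ∧ (∀ z ∈ T, ∀ w ∈ T, f z = f w) ∧
        T.card = k ∧ T.Nonempty := by
  obtain ⟨k, ψ, hk, hψ, hψp, hψ', hfψ, hord⟩ := exists_analyticAt_pow_eq hf hnc
  have hs := hψ.hasStrictDerivAt.hasStrictFDerivAt_equiv hψ'
  set e := hs.toOpenPartialHomeomorph ψ with he
  have hep : p ∈ e.source := hs.mem_toOpenPartialHomeomorph_source
  have hee : ∀ z, e z = ψ z := fun z ↦ rfl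
  refine ⟨k, hord, ⟨e.source ∩ {z | f z = f p + ψ z ^ k},
    inter_mem (e.open_source.mem_nhds hep) hfψ, ?_⟩, ?_⟩
  · intro T hT hfT
    rcases T.eq_empty_or_nonempty with rfl | ⟨z₀, hz₀⟩
    · simp
    have hinj : Set.InjOn ψ T := fun z hz w hw h ↦ e.injOn (hT hz).1 (hT hw).1 h
    rw [← Finset.card_image_of_injOn hinj]
    refine (Finset.card_le_card ?_).trans (Polynomial.card_nthRoots k (ψ z₀ ^ k) |>.trans' 
      (Multiset.toFinset_card_le _))
    intro w hw
    obtain ⟨z, hz, rfl⟩ := Finset.mem_image.mp hw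
    rw [Multiset.mem_toFinset, Polynomial.mem_nthRoots (Nat.pos_of_ne_zero hk)]
    have h1 : f z = f p + ψ z ^ k := (hT hz).2
    have h2 : f z₀ = f p + ψ z₀ ^ k := (hT hz₀).2
    have h3 := hfT z hz z₀ hz₀
    rw [h1, h2] at h3
    exact add_left_cancel h3
  · intro V hV
    have hW : e.source ∩ {z | f z = f p + ψ z ^ k} ∩ V ∈ 𝓝 p :=
      inter_mem (inter_mem (e.open_source.mem_nhds hep) hfψ) hV
    have hsymm : Tendsto e.symm (𝓝 0) (𝓝 p) := by
      have := e.symm.continuousAt (x := 0) (by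
        have := e.map_source hep
        rwa [hee, hψp] at this)
      have h0 : e.symm 0 = p := by
        rw [← hψp, ← hee]
        exact e.left_inv hep
      rw [ContinuousAt, h0] at this
      exact this
    have htar : e.target ∈ 𝓝 (0 : ℂ) := e.open_target.mem_nhds (by
        have := e.map_source hep
        rwa [hee, hψp] at this)
    obtain ⟨r, hr, hball⟩ := Metric.mem_nhds_iff.mp (inter_mem (hsymm hW) htar)
    have hζ := Complex.isPrimitiveRoot_exp k hk
    set ζ := Complex.exp (2 * Real.pi * Complex.I / k) with hζdef
    -- In the coordinate `ψ` the fibre over `f p + w ^ k` consists of the points `ζ ^ i * w`, which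
    -- all lie in the ball of radius `r`.
    set w : ℂ := ((r / 2 : ℝ) : ℂ) with hw
    have hw0 : w ≠ 0 := by
      rw [hw]
      exact_mod_cast (half_pos hr).ne'
    have hζn : ‖ζ‖ = 1 := hζ.norm'_eq_one hk
    have hmem : ∀ i : ℕ, ζ ^ i * w ∈ Metric.ball (0 : ℂ) r := by
      intro i
      rw [mem_ball_zero_iff, norm_mul, norm_pow, hζn, one_pow, one_mul, hw, Complex.norm_real,
        Real.norm_of_nonneg (half_pos hr).le]
      exact half_lt_self hr
    have hψe : ∀ i : ℕ, ψ (e.symm (ζ ^ i * w)) = ζ ^ i * w := fun i ↦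
      e.right_inv (hball (hmem i)).2
    refine ⟨(Finset.range k).image fun i ↦ e.symm (ζ ^ i * w), ?_, ?_, ?_, ?_, ?_⟩
    · intro z hz
      obtain ⟨i, -, rfl⟩ := Finset.mem_image.mp (Finset.mem_coe.mp hz)
      exact (hball (hmem i)).1.2
    · intro hp
      obtain ⟨i, -, hi⟩ := Finset.mem_image.mp hp
      have := hψe i
      rw [hi, hψp] at this
      exact mul_ne_zero (pow_ne_zero i (hζ.ne_zero hk)) hw0 this.symm
    · have hval : ∀ z ∈ (Finset.range k).image (fun i ↦ e.symm (ζ ^ i * w)), f z = f p + w ^ k := by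
        intro z hz
        obtain ⟨i, -, rfl⟩ := Finset.mem_image.mp hz
        have h1 : f (e.symm (ζ ^ i * w)) = f p + ψ (e.symm (ζ ^ i * w)) ^ k :=
          (hball (hmem i)).1.1.2
        rw [h1, hψe, mul_pow, ← pow_mul, mul_comm i k, pow_mul, hζ.pow_eq_one, one_pow, one_mul]
      intro z hz z' hz'
      rw [hval z hz, hval z' hz']
    · rw [Finset.card_image_of_injOn, Finset.card_range]
      intro i hi i' hi' h
      have h' := congrArg ψ h
      simp only [hψe] at h'
      exact hζ.pow_inj (Finset.mem_range.mp hi) (Finset.mem_range.mp hi') (mul_right_cancel₀ hw0 h')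
    · exact (Finset.nonempty_range_iff.mpr hk).image _

/-! ### Stabilizers in the modular group and the multiplicities of the modular invariant -/

lemma smul_eq_iff_num (γ : SL(2, ℤ)) (z w : ℍ) :
    γ • z = w ↔ (γ 0 0 * z + γ 0 1 : ℂ) = w * (γ 1 0 * z + γ 1 1) := by
  have h := denom_ne_zero γ z
  rw [ModularGroup.denom_apply] at h
  rw [UpperHalfPlane.ext_iff, UpperHalfPlane.coe_specialLinearGroup_apply, div_eq_iff]
  · simp
  · simpa using h

/-- Subtracting the two fixed-point equations and dividing by `z - p` leaves `c (z + p) + (d - a) =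
0`; its imaginary part kills `c`, as both points lie in the upper half-plane. -/
lemma eq_one_or_neg_one_of_smul_eq {γ : SL(2, ℤ)} {z p : ℍ} (hzp : z ≠ p) (hz : γ • z = z)
    (hp : γ • p = p) : γ = 1 ∨ γ = -1 := by
  rw [smul_eq_iff_num] at hz hp
  have hne : (z : ℂ) - p ≠ 0 := sub_ne_zero.mpr fun h ↦ hzp (UpperHalfPlane.ext h)
  have h1 : (γ 1 0 : ℂ) * (z + p) + (γ 1 1 - γ 0 0) = 0 := by
    refine mul_left_cancel₀ hne ?_
    linear_combination -hz + hp
  have hc : γ 1 0 = 0 := by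
    have := congrArg Complex.im h1
    simp only [Complex.add_im, Complex.mul_im, Complex.intCast_re, Complex.intCast_im,
      Complex.sub_im, zero_mul, add_zero, sub_zero, Complex.zero_im, UpperHalfPlane.coe_im] at this
    have h2 : (γ 1 0 : ℝ) = 0 := by
      rcases mul_eq_zero.mp this with h | h
      · exact h
      · exact absurd h (add_pos z.im_pos p.im_pos).ne'
    exact_mod_cast h2
  have hda : γ 1 1 = γ 0 0 := by
    rw [hc] at h1
    simp only [Int.cast_zero, zero_mul, zero_add, sub_eq_zero] at h1
    exact_mod_cast h1
  have hb : γ 0 1 = 0 := by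
    rw [hc, hda] at hz
    have : (γ 0 1 : ℂ) = 0 := by
      simp only [Int.cast_zero, zero_mul, zero_add] at hz
      linear_combination hz
    exact_mod_cast this
  have hdet := Matrix.SpecialLinearGroup.det_coe γ
  rw [Matrix.det_fin_two, hc, hda, mul_zero, sub_zero] at hdet
  rcases Int.mul_eq_one_iff_eq_one_or_neg_one.mp hdet with ⟨h, -⟩ | ⟨h, -⟩
  · left
    ext i j
    fin_cases i <;> fin_cases j <;> simp [hc, hb, hda, h]
  · right
    ext i j
    fin_cases i <;> fin_cases j <;> simp [hc, hb, hda, h]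

lemma finite_stabilizer (p : ℍ) : Finite (MulAction.stabilizer SL(2, ℤ) p) := by
  refine Set.Finite.subset (finite_setOf_smul_inter (isCompact_singleton (x := p))
    (isCompact_singleton (x := p))) fun γ hγ ↦ ⟨p, rfl, hγ⟩

/-- Orbit-stabilizer: among the elements fixing `p`, only `±1` also fix the second point `z`. -/
lemma card_orbit_stabilizer {p z : ℍ} (hzp : z ≠ p) :
    Nat.card (MulAction.stabilizer SL(2, ℤ) p) =
      2 * (MulAction.orbit (MulAction.stabilizer SL(2, ℤ) p) z).ncard := by
  have := finite_stabilizer p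
  set S := MulAction.stabilizer SL(2, ℤ) p with hS
  have hneg : (-1 : SL(2, ℤ)) ∈ S := by
    rw [hS, MulAction.mem_stabilizer_iff, ModularGroup.SL_neg_smul, one_smul]
  have hcard : Nat.card (MulAction.stabilizer S z) = 2 := by
    have hset : ((MulAction.stabilizer S z : Subgroup S) : Set S) =
        {1, ⟨-1, hneg⟩} := by
      ext γ
      constructor
      · intro h
        rcases eq_one_or_neg_one_of_smul_eq hzp h γ.2 with h | h
        · left; exact Subtype.ext h
        · right; exact Subtype.ext h
      · rintro (rfl | rfl)
        · exact one_mem _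
        · change (-1 : SL(2, ℤ)) • z = z
          rw [ModularGroup.SL_neg_smul, one_smul]
    have : Nat.card (MulAction.stabilizer S z) =
      ((MulAction.stabilizer S z : Subgroup S) : Set S).ncard := rfl
    rw [this, hset, Set.ncard_pair]
    intro h
    have h' := congrArg (fun γ : S ↦ (γ : SL(2, ℤ)) 0 0) h
    simp at h'
  rw [← MulAction.index_stabilizer, ← Subgroup.card_mul_index (MulAction.stabilizer S z), hcard]

/-- The function `jInv - jInv p` vanishes at `p` to the order given by the stabilizer of `p`. -/
theorem exists_order_jInv (p : ℍ) :
    ∃ k : ℕ, 2 * k = Nat.card (MulAction.stabilizer SL(2, ℤ) p) ∧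
      meromorphicOrderAt (fun z ↦ (jInv ∘ ofComplex) z - jInv p) p = (k : ℤ) := by
  obtain ⟨k, hk, ⟨V, hV, hle⟩, hex⟩ :=
    exists_card_fiber (analyticAt_jInv p.im_pos) (not_eventually_const_jInv p)
  refine ⟨k, ?_, by simpa using hk⟩
  have := finite_stabilizer p
  set S := MulAction.stabilizer SL(2, ℤ) p with hS
  have hev1 : ∀ᶠ z in 𝓝 p, ∀ γ : S, ((γ • z : ℍ) : ℂ) ∈ V := by
    refine eventually_all.mpr fun γ ↦ ?_
    have h1 : Tendsto (fun z : ℍ ↦ ((γ : SL(2, ℤ)) • z)) (𝓝 p) (𝓝 p) := by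
      have := (continuous_SL_smul γ).tendsto p
      rwa [show (γ : SL(2, ℤ)) • p = p from γ.2] at this
    exact ((continuous_coe.tendsto p).comp h1).eventually_mem hV
  have hev2 := (eventually_forall_smul_eq p p)
  obtain ⟨W, hW, W', hW', hWW'⟩ := mem_prod_iff.mp hev2
  have hN : W ∩ W' ∩ {z | ∀ γ : S, ((γ • z : ℍ) : ℂ) ∈ V} ∈ 𝓝 p := inter_mem (inter_mem hW hW') hev1
  obtain ⟨T, hTV, hpT, hfT, hcard, hne⟩ := hex _ (isOpenEmbedding_coe.image_mem_nhds.mpr hN)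
  obtain ⟨z₀', hz₀T⟩ := hne
  obtain ⟨z₀, hz₀, rfl⟩ := hTV hz₀T
  have hz₀p : z₀ ≠ p := by
    rintro rfl
    exact hpT hz₀T
  rw [card_orbit_stabilizer hz₀p]
  congr 1
  have hfin : (UpperHalfPlane.coe '' (MulAction.orbit S z₀)).Finite :=
    (Set.finite_range _).image _
  have hnc : (MulAction.orbit S z₀).ncard = hfin.toFinset.card := by
    rw [← Set.ncard_eq_toFinset_card _ hfin,
      Set.ncard_image_of_injective _ isOpenEmbedding_coe.injective]
  rw [hnc]
  -- Near `p`, points with the same `jInv` differ by an element fixing `p`, so a nearby fibre lies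
  -- in one orbit of the stabilizer. Conversely that orbit lies in a fibre inside `V`, where fibres
  -- have at most `k` points.
  apply le_antisymm
  · rw [← hcard]
    refine Finset.card_le_card fun w' hw' ↦ ?_
    obtain ⟨w, hw, rfl⟩ := hTV hw'
    rw [Set.Finite.mem_toFinset]
    have hj := hfT _ hz₀T _ hw'
    simp only [Function.comp_apply, ofComplex_apply] at hj
    obtain ⟨γ, hγ⟩ := exists_smul_eq_of_jInv_eq hj
    have hγp : γ • p = p := hWW' (Set.mk_mem_prod hz₀.1.1 hw.1.2) γ hγ
    exact ⟨w, ⟨⟨γ, hγp⟩, hγ⟩, rfl⟩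
  · refine hle _ ?_ ?_
    · intro w hw
      rw [Set.Finite.coe_toFinset] at hw
      obtain ⟨_, ⟨γ, rfl⟩, rfl⟩ := hw
      exact hz₀.2 γ
    · have hval : ∀ w ∈ hfin.toFinset, (jInv ∘ ofComplex) w = jInv z₀ := by
        intro w hw
        rw [Set.Finite.mem_toFinset] at hw
        obtain ⟨_, ⟨γ, rfl⟩, rfl⟩ := hw
        simp only [Function.comp_apply, ofComplex_apply]
        exact jInv_smul γ z₀
      intro z hz w hw
      rw [hval z hz, hval w hw]

lemma order_jInv_eq_zero {p q : ℍ} (h : ∀ γ : SL(2, ℤ), γ • p ≠ q) :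
    meromorphicOrderAt (fun z ↦ (jInv ∘ ofComplex) z - jInv q) p = 0 := by
  have han : AnalyticAt ℂ (fun z ↦ (jInv ∘ ofComplex) z - jInv q) p :=
    (analyticAt_jInv p.im_pos).sub analyticAt_const
  refine (tendsto_ne_zero_iff_meromorphicOrderAt_eq_zero han.meromorphicAt).mp
    ⟨_, ?_, han.continuousAt.tendsto.mono_left nhdsWithin_le_nhds⟩
  simp only [Function.comp_apply, ofComplex_apply]
  intro h0
  obtain ⟨γ, hγ⟩ := exists_smul_eq_of_jInv_eq (sub_eq_zero.mp h0)
  exact h γ hγ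

end ModularSchwarz

namespace ModularSchwarz
open CongruenceSubgroup

/-! ### Counting cosets -/

/-- The set is the image of `S` in `G ⧸ N`, translated by `g`. It is applied with `S` the stabilizer
of a point and of the cusp `∞`. -/
lemma ncard_cosets {G : Type*} [Group G] (N : Subgroup G) [hN : N.Normal] (S : Subgroup G) (g : G) :
    {x : G ⧸ N | ∃ γ ∈ N, g⁻¹ * γ * x.out ∈ S}.ncard =
      Nat.card (S.map (QuotientGroup.mk' N)) := by
  have hset : {x : G ⧸ N | ∃ γ ∈ N, g⁻¹ * γ * x.out ∈ S} =
      (fun y : G ⧸ N ↦ (g : G ⧸ N) * y) '' (S.map (QuotientGroup.mk' N)) := by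
    ext x
    constructor
    · rintro ⟨γ, hγ, hx⟩
      refine ⟨_, ⟨_, hx, rfl⟩, ?_⟩
      have h1 : ((γ : G) : G ⧸ N) = 1 := (QuotientGroup.eq_one_iff γ).mpr hγ
      simp [h1]
    · rintro ⟨_, ⟨s, hs, rfl⟩, rfl⟩
      set x : G ⧸ N := (g : G ⧸ N) * QuotientGroup.mk' N s with hx
      have hxgs : (x.out : G ⧸ N) = ((g * s : G) : G ⧸ N) := by
        rw [QuotientGroup.out_eq', hx]
        rfl
      have hmem := hN.conj_mem _ (QuotientGroup.eq.mp hxgs) x.out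
      refine ⟨g * s * x.out⁻¹, by simpa [mul_assoc] using hmem, ?_⟩
      have : g⁻¹ * (g * s * x.out⁻¹) * x.out = s := by group
      rwa [this]
  rw [hset, Set.ncard_image_of_injective _ (mul_right_injective _)]
  rfl

lemma card_map_mul_card_inf {G : Type*} [Group G] (N : Subgroup G) [N.Normal] (S : Subgroup G) :
    Nat.card (S.map (QuotientGroup.mk' N)) * Nat.card ↥(N ⊓ S) = Nat.card S := by
  have h := Subgroup.relIndex_mul_relIndex ⊥ (N ⊓ S) S bot_le inf_le_right
  rw [Subgroup.relIndex_bot_left, Subgroup.relIndex_bot_left, Subgroup.inf_relIndex_right] at h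
  rw [← h, mul_comm, ← Subgroup.relIndex_ker, QuotientGroup.ker_mk']

instance instNormalGamma (m : ℕ) : (Gamma m).Normal := Gamma_normal m

/-- The number of elements of `{±1}` which belong to `Γ(m)`. -/
noncomputable def signCard (m : ℕ) : ℕ := {γ : SL(2, ℤ) | γ ∈ Gamma m ∧ (γ = 1 ∨ γ = -1)}.ncard

lemma intCast_eq_one_iff_dvd {m : ℕ} {a : ℤ} : (a : ZMod m) = 1 ↔ (m : ℤ) ∣ a - 1 := by
  rw [← sub_eq_zero, ← ZMod.intCast_zmod_eq_zero_iff_dvd]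
  push_cast
  rfl

/-- The groups `Γ(m)` with `m ≥ 2` contain no elliptic elements. -/
lemma eq_one_or_neg_one_of_mem_Gamma {m : ℕ} (hm : 2 ≤ m) {γ : SL(2, ℤ)} (hγ : γ ∈ Gamma m)
    {z : ℍ} (hz : γ • z = z) : γ = 1 ∨ γ = -1 := by
  rw [smul_eq_iff_num] at hz
  obtain ⟨h00, h01, h10, h11⟩ := Gamma_mem.mp hγ
  rw [intCast_eq_one_iff_dvd] at h00 h11
  rw [ZMod.intCast_zmod_eq_zero_iff_dvd] at h01 h10
  have hdet := Matrix.SpecialLinearGroup.det_coe γ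
  rw [Matrix.det_fin_two] at hdet
  have hy := z.im_pos
  have hre := congrArg Complex.re hz
  have him := congrArg Complex.im hz
  simp only [Complex.add_re, Complex.mul_re, Complex.add_im, Complex.mul_im, Complex.intCast_re,
    Complex.intCast_im, zero_mul, sub_zero, add_zero, UpperHalfPlane.coe_im,
    UpperHalfPlane.coe_re] at hre him
  set x := z.re
  set y := z.im
  set a := γ 0 0
  set b := γ 0 1
  set c := γ 1 0
  set d := γ 1 1
  have h1 : (a : ℝ) - d = 2 * c * x := by
    refine mul_left_cancel₀ hy.ne' ?_
    linear_combination him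
  have h2 : (b : ℝ) = -c * (x ^ 2 + y ^ 2) := by
    linear_combination hre - x * h1
  have hdetR : (a : ℝ) * d - b * c = 1 := by exact_mod_cast hdet
  have htr : ((a : ℝ) + d) ^ 2 = 4 - 4 * (c * y) ^ 2 := by
    linear_combination (a - d + 2 * c * x) * h1 + 4 * c * h2 + 4 * hdetR
  by_cases hc : c = 0
  · have hda : d = a := by
      have : (a : ℝ) - d = 0 := by rw [h1, hc]; simp
      have h3 : (a : ℝ) = d := sub_eq_zero.mp this
      exact_mod_cast h3.symm
    have hb : b = 0 := by
      have : (b : ℝ) = 0 := by rw [h2, hc]; simp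
      exact_mod_cast this
    rw [hc, hda, mul_zero, sub_zero] at hdet
    rcases Int.mul_eq_one_iff_eq_one_or_neg_one.mp hdet with ⟨h, -⟩ | ⟨h, -⟩
    · left
      ext i j
      fin_cases i <;> fin_cases j <;>
        simp [show γ 0 0 = 1 from h, show γ 0 1 = 0 from hb, show γ 1 0 = 0 from hc,
          show γ 1 1 = 1 from hda.trans h]
    · right
      ext i j
      fin_cases i <;> fin_cases j <;>
        simp [show γ 0 0 = -1 from h, show γ 0 1 = 0 from hb, show γ 1 0 = 0 from hc,
          show γ 1 1 = -1 from hda.trans h]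
  · exfalso
    -- With `c ≠ 0` the element is elliptic, so `0 < 2 - (a + d) < 4`. But the congruences and `ad -
    -- bc = 1` make `2 - (a + d)` divisible by `m ^ 2 ≥ 4`.
    have hlt : (a + d) ^ 2 < 4 := by
      have : ((a : ℝ) + d) ^ 2 < 4 := by
        rw [htr]
        have : 0 < ((c : ℝ) * y) ^ 2 := by
          have : (c : ℝ) ≠ 0 := by exact_mod_cast hc
          positivity
        linarith
      exact_mod_cast this
    have hdvd : (m : ℤ) * m ∣ 2 - (a + d) := by
      have h3 : 2 - (a + d) = (a - 1) * (d - 1) - b * c := by linear_combination -hdet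
      rw [h3]
      exact dvd_sub (mul_dvd_mul h00 h11) (mul_dvd_mul h01 h10)
    have hm4 : (4 : ℤ) ≤ m * m := by
      have : (2 : ℤ) ≤ m := by exact_mod_cast hm
      nlinarith
    have hlt1 : a + d < 2 := by nlinarith
    have hlt2 : -2 < a + d := by nlinarith
    have := Int.le_of_dvd (by omega) hdvd
    omega

lemma signCard_mul_card_map_stabilizer {m : ℕ} (hm : 2 ≤ m) (p : ℍ) :
    signCard m * Nat.card ((MulAction.stabilizer SL(2, ℤ) p).map (QuotientGroup.mk' (Gamma m))) =
      Nat.card (MulAction.stabilizer SL(2, ℤ) p) := by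
  rw [← card_map_mul_card_inf (Gamma m), mul_comm]
  congr 1
  refine congrArg Set.ncard (?_ : _ = ((Gamma m ⊓ MulAction.stabilizer SL(2, ℤ) p :
    Subgroup SL(2, ℤ)) : Set SL(2, ℤ)))
  ext γ
  constructor
  · rintro ⟨h, rfl | rfl⟩
    · exact one_mem _
    · refine ⟨h, ?_⟩
      change (-1 : SL(2, ℤ)) • p = p
      rw [ModularGroup.SL_neg_smul, one_smul]
  · rintro ⟨h, h'⟩
    exact ⟨h, eq_one_or_neg_one_of_mem_Gamma hm h h'⟩

/-- The stabilizer of the cusp `∞` in the modular group. -/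
noncomputable def stabilizerInfty : Subgroup SL(2, ℤ) :=
  (MulAction.stabilizer (GL (Fin 2) ℝ) (OnePoint.infty : OnePoint ℝ)).comap
    (Matrix.SpecialLinearGroup.mapGL ℝ)

lemma mem_stabilizerInfty {γ : SL(2, ℤ)} : γ ∈ stabilizerInfty ↔ γ 1 0 = 0 := by
  rw [stabilizerInfty, Subgroup.mem_comap, MulAction.mem_stabilizer_iff,
    OnePoint.smul_infty_eq_self_iff]
  simp

/-- Matrices of determinant one as quadruples. -/
def slEquiv (R : Type*) [CommRing R] :
    SL(2, R) ≃ {v : R × R × R × R // v.1 * v.2.2.2 - v.2.1 * v.2.2.1 = 1} where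
  toFun A := ⟨(A 0 0, A 0 1, A 1 0, A 1 1), by
    have := Matrix.SpecialLinearGroup.det_coe A
    rwa [Matrix.det_fin_two] at this⟩
  invFun v := ⟨!![v.1.1, v.1.2.1; v.1.2.2.1, v.1.2.2.2], by
    rw [Matrix.det_fin_two_of]
    exact v.2⟩
  left_inv A := by
    ext i j
    fin_cases i <;> fin_cases j <;> rfl
  right_inv v := rfl

/-- Two matrices of determinant one with the same bottom row differ by a left unipotent factor, so
it is enough to lift the bottom row to a coprime pair of integers. -/
lemma map_castRingHom_surjective {m : ℕ}
    (h : ∀ c d : ZMod m, IsCoprime c d → ∃ c' d' : ℤ, IsCoprime c' d' ∧ (c' : ZMod m) = c ∧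
      (d' : ZMod m) = d) :
    Function.Surjective
      (Matrix.SpecialLinearGroup.map (n := Fin 2) (Int.castRingHom (ZMod m))) := by
  intro A
  obtain ⟨c', d', hcop, hc, hd⟩ := h (A 1 0) (A 1 1) (ModularGroup.bottom_row_coprime A)
  obtain ⟨g, -, hg⟩ := ModularGroup.bottom_row_surj (R := ℤ) (show ![c', d'] ∈ _ from hcop)
  have hg0 : g 1 0 = c' := congrFun hg 0
  have hg1 : g 1 1 = d' := congrFun hg 1
  set B := Matrix.SpecialLinearGroup.map (n := Fin 2) (Int.castRingHom (ZMod m)) g with hB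
  have hB0 : B 1 0 = A 1 0 := by
    rw [← hc, ← hg0]
    rfl
  have hB1 : B 1 1 = A 1 1 := by
    rw [← hd, ← hg1]
    rfl
  -- The upper right entry of `A * B⁻¹`.
  obtain ⟨t, ht⟩ := ZMod.intCast_surjective (A 0 1 * B 0 0 - A 0 0 * B 0 1)
  refine ⟨ModularGroup.T ^ t * g, ?_⟩
  have hA := Matrix.SpecialLinearGroup.det_coe A
  have hBd := Matrix.SpecialLinearGroup.det_coe B
  rw [Matrix.det_fin_two] at hA hBd
  rw [hB0, hB1] at hBd
  have hT : ∀ i j, Matrix.SpecialLinearGroup.map (n := Fin 2) (Int.castRingHom (ZMod m))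
      (ModularGroup.T ^ t) i j = (!![1, (t : ZMod m); 0, 1] : Matrix (Fin 2) (Fin 2) (ZMod m)) i j := by
    intro i j
    rw [SL_reduction_mod_hom_val, ModularGroup.coe_T_zpow]
    fin_cases i <;> fin_cases j <;> simp
  rw [map_mul, ← hB]
  ext i j
  rw [Matrix.SpecialLinearGroup.coe_mul, Matrix.mul_apply, Fin.sum_univ_two, hT, hT]
  fin_cases i <;> fin_cases j
  · simp [hB0, ht]
    linear_combination (-(B 0 0)) * hA + A 0 0 * hBd
  · simp [hB1, ht]
    linear_combination (-(B 0 1)) * hA + A 0 1 * hBd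
  · simp [hB0]
  · simp [hB1]

lemma card_quotient_Gamma {m : ℕ}
    (h : Function.Surjective
      (Matrix.SpecialLinearGroup.map (n := Fin 2) (Int.castRingHom (ZMod m)))) :
    Nat.card (SL(2, ℤ) ⧸ Gamma m) = Nat.card SL(2, ZMod m) := by
  change (Gamma m).index = _
  rw [Gamma, Subgroup.index_ker, MonoidHom.range_eq_top.mpr h]
  exact Nat.card_congr Subgroup.topEquiv.toEquiv

/-- `Γ(m)` is the kernel of reduction, so the image can be counted in `SL(2, ZMod m)`, where it
consists of the reductions of `±T ^ t`. The quadruple form makes the count decidable. -/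
lemma card_map_stabilizerInfty (m : ℕ) :
    Nat.card (stabilizerInfty.map (QuotientGroup.mk' (Gamma m))) =
      Nat.card {v : ZMod m × ZMod m × ZMod m × ZMod m // v.1 * v.2.2.2 - v.2.1 * v.2.2.1 = 1 ∧
        v.2.2.1 = 0 ∧ v.1 = v.2.2.2 ∧ (v.1 = 1 ∨ v.1 = -1)} := by
  rw [← Subgroup.relIndex_ker, QuotientGroup.ker_mk', Gamma, Subgroup.relIndex_ker]
  refine Nat.card_congr (((slEquiv (ZMod m)).subtypeEquiv (q := fun v ↦
    v.1.2.2.1 = 0 ∧ v.1.1 = v.1.2.2.2 ∧ (v.1.1 = 1 ∨ v.1.1 = -1)) fun A ↦ ?_).trans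
    (Equiv.subtypeSubtypeEquivSubtypeInter (fun v : ZMod m × ZMod m × ZMod m × ZMod m ↦
      v.1 * v.2.2.2 - v.2.1 * v.2.2.1 = 1) (fun v ↦ v.2.2.1 = 0 ∧ v.1 = v.2.2.2 ∧
        (v.1 = 1 ∨ v.1 = -1))))
  change A ∈ stabilizerInfty.map _ ↔ A 1 0 = 0 ∧ A 0 0 = A 1 1 ∧ (A 0 0 = 1 ∨ A 0 0 = -1)
  constructor
  · rintro ⟨γ, hγ, rfl⟩
    have hγ := mem_stabilizerInfty.mp hγ
    have hdet := Matrix.SpecialLinearGroup.det_coe γ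
    rw [Matrix.det_fin_two, hγ, mul_zero, sub_zero] at hdet
    simp only [SL_reduction_mod_hom_val, hγ]
    rcases Int.mul_eq_one_iff_eq_one_or_neg_one.mp hdet with ⟨h, h'⟩ | ⟨h, h'⟩ <;> simp [h, h']
  · rintro ⟨h0, h1, h2⟩
    obtain ⟨t, ht⟩ := ZMod.intCast_surjective (A 0 1)
    rcases h2 with h2 | h2
    · refine ⟨ModularGroup.T ^ t, mem_stabilizerInfty.mpr (by simp [ModularGroup.coe_T_zpow]), ?_⟩
      ext i j
      rw [SL_reduction_mod_hom_val, ModularGroup.coe_T_zpow]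
      fin_cases i <;> fin_cases j <;> simp [h0, ← h1, h2, ht]
    · refine ⟨-ModularGroup.T ^ (-t), mem_stabilizerInfty.mpr (by
        rw [Matrix.SpecialLinearGroup.coe_neg, ModularGroup.coe_T_zpow]; simp), ?_⟩
      ext i j
      rw [SL_reduction_mod_hom_val, Matrix.SpecialLinearGroup.coe_neg, ModularGroup.coe_T_zpow]
      fin_cases i <;> fin_cases j <;> simp [h0, ← h1, h2, ht]

lemma signCard_eq_two {m : ℕ} (h : -1 ∈ Gamma m) : signCard m = 2 := by
  have : {γ : SL(2, ℤ) | γ ∈ Gamma m ∧ (γ = 1 ∨ γ = -1)} = {1, -1} := by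
    ext γ
    constructor
    · rintro ⟨-, h⟩
      exact h
    · rintro (rfl | rfl)
      · exact ⟨one_mem _, .inl rfl⟩
      · exact ⟨h, .inr rfl⟩
  rw [signCard, this, Set.ncard_pair]
  intro h
  have h' := congrArg (fun γ : SL(2, ℤ) ↦ γ 0 0) h
  simp at h'

lemma signCard_eq_one {m : ℕ} (h : -1 ∉ Gamma m) : signCard m = 1 := by
  have : {γ : SL(2, ℤ) | γ ∈ Gamma m ∧ (γ = 1 ∨ γ = -1)} = {1} := by
    ext γ
    constructor
    · rintro ⟨h', rfl | rfl⟩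
      · rfl
      · exact absurd h' h
    · rintro rfl
      exact ⟨one_mem _, .inl rfl⟩
  rw [signCard, this, Set.ncard_singleton]

lemma group_data_of_decide {m δ M C : ℕ} [NeZero m]
    (hneg : (-1 ∈ Gamma m ∧ δ = 2) ∨ (-1 ∉ Gamma m ∧ δ = 1))
    (hcop : ∀ c d : ZMod m, IsCoprime c d → ∃ c' d' : ℤ, IsCoprime c' d' ∧ (c' : ZMod m) = c ∧
      (d' : ZMod m) = d)
    (hM : Fintype.card {v : ZMod m × ZMod m × ZMod m × ZMod m //
      v.1 * v.2.2.2 - v.2.1 * v.2.2.1 = 1} = M)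
    (hC : Fintype.card {v : ZMod m × ZMod m × ZMod m × ZMod m //
      v.1 * v.2.2.2 - v.2.1 * v.2.2.1 = 1 ∧
        v.2.2.1 = 0 ∧ v.1 = v.2.2.2 ∧ (v.1 = 1 ∨ v.1 = -1)} = C) :
    signCard m = δ ∧ Nat.card (SL(2, ℤ) ⧸ Gamma m) = M ∧
      Nat.card (stabilizerInfty.map (QuotientGroup.mk' (Gamma m))) = C := by
  refine ⟨?_, ?_, ?_⟩
  · rcases hneg with ⟨h, rfl⟩ | ⟨h, rfl⟩
    · exact signCard_eq_two h
    · exact signCard_eq_one h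
  · rw [card_quotient_Gamma (map_castRingHom_surjective hcop), Nat.card_congr (slEquiv _),
      Nat.card_eq_fintype_card, hM]
  · rw [card_map_stabilizerInfty, Nat.card_eq_fintype_card, hC]

/-- Restricting lifts to numbers below 10 makes the hypothesis a finite check; this range is large
enough for `m ≤ 5`. -/
lemma exists_isCoprime_lift {m : ℕ}
    (h : ∀ c d : ZMod m, (∃ a b : ZMod m, a * c + b * d = 1) →
      ∃ i j : Fin 10, Nat.gcd i j = 1 ∧ ((i : ℕ) : ZMod m) = c ∧ ((j : ℕ) : ZMod m) = d) :
    ∀ c d : ZMod m, IsCoprime c d → ∃ c' d' : ℤ, IsCoprime c' d' ∧ (c' : ZMod m) = c ∧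
      (d' : ZMod m) = d := by
  intro c d hcd
  obtain ⟨i, j, hij, hi, hj⟩ := h c d hcd
  exact ⟨(i : ℕ), (j : ℕ), Nat.isCoprime_iff_coprime.mpr hij, by exact_mod_cast hi,
    by exact_mod_cast hj⟩

lemma group_data_two : signCard 2 = 2 ∧ Nat.card (SL(2, ℤ) ⧸ Gamma 2) = 6 ∧
    Nat.card (stabilizerInfty.map (QuotientGroup.mk' (Gamma 2))) = 2 :=
  group_data_of_decide (.inl ⟨by rw [Gamma_mem]; simp, rfl⟩)
    (exists_isCoprime_lift (by decide +kernel)) (by decide +kernel) (by decide +kernel)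

lemma group_data_three : signCard 3 = 1 ∧ Nat.card (SL(2, ℤ) ⧸ Gamma 3) = 24 ∧
    Nat.card (stabilizerInfty.map (QuotientGroup.mk' (Gamma 3))) = 6 :=
  group_data_of_decide (.inr ⟨by rw [Gamma_mem]; simp; decide, rfl⟩)
    (exists_isCoprime_lift (by decide +kernel)) (by decide +kernel) (by decide +kernel)

lemma group_data_four : signCard 4 = 1 ∧ Nat.card (SL(2, ℤ) ⧸ Gamma 4) = 48 ∧
    Nat.card (stabilizerInfty.map (QuotientGroup.mk' (Gamma 4))) = 8 :=
  group_data_of_decide (.inr ⟨by rw [Gamma_mem]; simp; decide, rfl⟩)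
    (exists_isCoprime_lift (by decide +kernel)) (by decide +kernel) (by decide +kernel)

lemma group_data_five : signCard 5 = 1 ∧ Nat.card (SL(2, ℤ) ⧸ Gamma 5) = 120 ∧
    Nat.card (stabilizerInfty.map (QuotientGroup.mk' (Gamma 5))) = 10 :=
  group_data_of_decide (.inr ⟨by rw [Gamma_mem]; simp; decide, rfl⟩)
    (exists_isCoprime_lift (by decide +kernel)) (by decide +kernel) (by decide +kernel)

end ModularSchwarz

namespace ModularSchwarz
open Filter Topology

/-! ### Local analysis of the Schwarz derivative -/

lemma schwarzDeriv_eq {F L : ℂ → ℂ} {z L' : ℂ}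
    (h : ∀ᶠ w in 𝓝 z, deriv (deriv F) w / deriv F w = L w) (hL : HasDerivAt L L' z) :
    schwarzDeriv F z = L' - 1 / 2 * L z ^ 2 := by
  have h1 : (fun w ↦ deriv (deriv F) w / deriv F w) =ᶠ[𝓝 z] L := h
  rw [schwarzDeriv, h1.deriv_eq, hL.deriv, h.self_of_nhds]

lemma schwarzDeriv_eq_zero {F : ℂ → ℂ} {z : ℂ} (h : ∀ᶠ w in 𝓝 z, deriv F w = 0) :
    schwarzDeriv F z = 0 := by
  rw [schwarzDeriv_eq (L := fun _ ↦ 0) (h.mono fun w hw ↦ by simp [hw]) (hasDerivAt_const _ _)]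
  simp

lemma eventually_eventually_nhdsNE {p : ℂ} {P : ℂ → Prop} (h : ∀ᶠ z in 𝓝[≠] p, P z) :
    ∀ᶠ z in 𝓝[≠] p, ∀ᶠ w in 𝓝 z, P w :=
  (eventually_nhdsWithin_eventually_nhds_iff_of_isOpen isOpen_compl_singleton).mpr h

/-- With `F' = (z - p) ^ l * g` and `u = g' / g`, the logarithmic derivative of `F'` is `l / (z - p)
+ u`. So `(z - p) ^ 2` times the Schwarzian tends to `-l - l ^ 2 / 2`, which must be `0` as `E` is
continuous. A pole of `F` makes `l` negative, otherwise `l ≥ 0`. -/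
lemma order_deriv_of_schwarzDeriv {F E : ℂ → ℂ} {p : ℂ} (hF : MeromorphicAt F p)
    (hE : ContinuousAt E p) (hE0 : ¬ ∀ᶠ z in 𝓝[≠] p, E z = 0)
    (hS : ∀ᶠ z in 𝓝[≠] p, schwarzDeriv F z = E z) :
    meromorphicOrderAt (deriv F) p = ((if meromorphicOrderAt F p < 0 then -2 else 0 : ℤ)) := by
  have hD : MeromorphicAt (deriv F) p := hF.deriv
  -- If `F'` vanished near `p`, division by zero would give Schwarzian `0`, contrary to `hE0`.
  have hne : meromorphicOrderAt (deriv F) p ≠ ⊤ := by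
    intro htop
    rw [meromorphicOrderAt_eq_top_iff] at htop
    refine hE0 ?_
    filter_upwards [eventually_eventually_nhdsNE htop, hS] with z hz hz'
    rw [← hz', schwarzDeriv_eq_zero hz]
  obtain ⟨l, hl⟩ := WithTop.ne_top_iff_exists.mp hne
  obtain ⟨g, hg, hgp, hDg⟩ := (meromorphicOrderAt_eq_int_iff hD).mp hl.symm
  have hu : AnalyticAt ℂ (fun z ↦ deriv g z / g z) p := hg.deriv.div hg hgp
  set u := fun z ↦ deriv g z / g z with hudef
  have hev : ∀ᶠ z in 𝓝[≠] p, z ≠ p ∧ AnalyticAt ℂ g z ∧ g z ≠ 0 ∧ AnalyticAt ℂ u z ∧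
      deriv F z = (z - p) ^ l * g z := by
    filter_upwards [self_mem_nhdsWithin, hg.eventually_analyticAt.filter_mono nhdsWithin_le_nhds,
      (hg.continuousAt.eventually_ne hgp).filter_mono nhdsWithin_le_nhds,
      hu.eventually_analyticAt.filter_mono nhdsWithin_le_nhds, hDg] with z h1 h2 h3 h4 h5
    exact ⟨h1, h2, h3, h4, h5⟩
  have hmain : ∀ᶠ z in 𝓝[≠] p,
      (z - p) ^ 2 * E z = -l + (z - p) ^ 2 * deriv u z - 1 / 2 * (l + (z - p) * u z) ^ 2 := by
    filter_upwards [eventually_eventually_nhdsNE hev, hS] with z hz hSz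
    have hzp : z - p ≠ 0 := sub_ne_zero.mpr hz.self_of_nhds.1
    have hlog : ∀ᶠ w in 𝓝 z, deriv (deriv F) w / deriv F w = l / (w - p) + u w := by
      filter_upwards [hz, hz.eventually_nhds] with w ⟨hwp, hgw, hgw0, huw, hDw⟩ hw
      have hwp' : w - p ≠ 0 := sub_ne_zero.mpr hwp
      have h1 : deriv F =ᶠ[𝓝 w] fun w ↦ (w - p) ^ l * g w := hw.mono fun _ h ↦ h.2.2.2.2
      have h2 : HasDerivAt (fun w ↦ (w - p) ^ l) (l * (w - p) ^ (l - 1)) w := by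
        have := (hasDerivAt_zpow l (w - p) (.inl hwp')).comp w ((hasDerivAt_id w).sub_const p)
        simpa [Function.comp_def] using this
      have h3 : HasDerivAt (fun w ↦ (w - p) ^ l * g w)
          (l * (w - p) ^ (l - 1) * g w + (w - p) ^ l * deriv g w) w :=
        h2.mul hgw.differentiableAt.hasDerivAt
      rw [h1.deriv_eq, h3.deriv, hDw, hudef, zpow_sub_one₀ hwp']
      have := zpow_ne_zero l hwp'
      field_simp
    have hder : HasDerivAt (fun w ↦ l / (w - p) + u w) (-l / (z - p) ^ 2 + deriv u z) z := by
      have h1 : HasDerivAt (fun w ↦ (l : ℂ) / (w - p)) (-l / (z - p) ^ 2) z := by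
        simpa using HasDerivAt.fun_div (hasDerivAt_const z (l : ℂ))
          ((hasDerivAt_id' z).sub_const p) hzp
      exact h1.add hz.self_of_nhds.2.2.2.1.differentiableAt.hasDerivAt
    rw [← hSz, schwarzDeriv_eq hlog hder]
    field_simp
  have hp0 : Tendsto (fun z : ℂ ↦ z - p) (𝓝[≠] p) (𝓝 0) := by
    have : Tendsto (fun z : ℂ ↦ z - p) (𝓝 p) (𝓝 (p - p)) := (continuous_sub_right p).tendsto p
    rw [sub_self] at this
    exact this.mono_left nhdsWithin_le_nhds
  have hlim1 : Tendsto (fun z ↦ (z - p) ^ 2 * E z) (𝓝[≠] p) (𝓝 (0 ^ 2 * E p)) :=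
    (hp0.pow 2).mul (hE.tendsto.mono_left nhdsWithin_le_nhds)
  have hlim2 : Tendsto (fun z ↦ -(l : ℂ) + (z - p) ^ 2 * deriv u z -
      1 / 2 * (l + (z - p) * u z) ^ 2) (𝓝[≠] p)
      (𝓝 (-l + 0 ^ 2 * deriv u p - 1 / 2 * (l + 0 * u p) ^ 2)) :=
    ((((hp0.pow 2).mul (hu.deriv.continuousAt.tendsto.mono_left nhdsWithin_le_nhds)).const_add
      _)).sub ((((hp0.mul (hu.continuousAt.tendsto.mono_left nhdsWithin_le_nhds)).const_add
      _).pow 2).const_mul _)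
  have heq := tendsto_nhds_unique (hlim1.congr' hmain) hlim2
  have hl2 : l * (l + 2) = 0 := by
    have : (l : ℂ) * (l + 2) = 0 := by linear_combination 2 * heq
    exact_mod_cast this
  rw [← hl]
  congr 1
  split_ifs with hneg
  · obtain ⟨k, hk⟩ := WithTop.ne_top_iff_exists.mp (ne_top_of_lt hneg)
    rw [← hk] at hneg
    have hk0 : k < 0 := by exact_mod_cast hneg
    have h1 := meromorphicOrderAt_deriv_eq_sub_one (n := k) (by exact_mod_cast hk0.ne) hk.symm
    rw [← hl] at h1
    have : l = k - 1 := by exact_mod_cast h1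
    rcases mul_eq_zero.mp hl2 with h | h <;> omega
  · obtain ⟨G, hG, hFG⟩ := hF.meromorphicOrderAt_nonneg_iff.mp (not_lt.mp hneg)
    have h1 : deriv F =ᶠ[𝓝[≠] p] deriv G :=
      (eventually_eventually_nhdsNE hFG).mono fun z hz ↦ EventuallyEq.deriv_eq hz
    have h2 : 0 ≤ meromorphicOrderAt (deriv F) p := by
      rw [meromorphicOrderAt_congr h1]
      exact hG.deriv.meromorphicOrderAt_nonneg
    rw [← hl] at h2
    have : 0 ≤ l := by exact_mod_cast h2
    rcases mul_eq_zero.mp hl2 with h | h <;> omega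

/-- The exceptional set of the Schwarzian equation is only discrete in the half-plane and may a
priori accumulate at `i∞`, so near a cusp equality is available only frequently. -/
lemma eq_of_tendsto_of_frequently_eq {α : Type*} {l : Filter α} {f g : α → ℂ} {a b : ℂ}
    (hf : Tendsto f l (𝓝 a)) (hg : Tendsto g l (𝓝 b)) (h : ∃ᶠ x in l, f x = g x) : a = b := by
  by_contra hab
  have h1 : Tendsto (fun x ↦ f x - g x) l (𝓝 (a - b)) := hf.sub hg
  obtain ⟨x, hx, hx'⟩ := (h.and_eventually (h1.eventually_ne (sub_ne_zero.mpr hab))).exists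
  exact hx' (sub_eq_zero.mpr hx)

lemma hasDerivAt_qParam (m : ℕ) (z : ℂ) :
    HasDerivAt (Function.Periodic.qParam m)
      (2 * Real.pi * Complex.I / m * Function.Periodic.qParam m z) z := by
  have h1 : HasDerivAt (fun z : ℂ ↦ 2 * Real.pi * Complex.I * z / m)
      (2 * Real.pi * Complex.I * 1 / m) z := ((hasDerivAt_id z).const_mul _).div_const _
  have := h1.cexp
  simp only [mul_one] at this
  convert! this using 1
  simp only [Function.Periodic.qParam, Complex.ofReal_natCast]
  ring

/-- Behaviour at a cusp of a solution of a Schwarzian equation: the function behaves like a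
nonzero power of the local parameter (up to an additive constant). -/
lemma exists_exponent_of_schwarzDeriv {m : ℕ} (hm : 0 < m) {F₀ H E : ℂ → ℂ} {e : ℂ} (he : e ≠ 0)
    (hF : MeromorphicAt F₀ 0)
    (hH : ∀ z : ℂ, 0 < z.im → H z = F₀ (Function.Periodic.qParam m z))
    (hE : Tendsto E (comap Complex.im atTop) (𝓝 e))
    (hS : ∃ᶠ z in comap Complex.im atTop, schwarzDeriv H z = E z) :
    ∃ k : ℤ, (meromorphicOrderAt F₀ 0 < 0 ↔ k < 0) ∧
      e = 2 * (Real.pi : ℂ) ^ 2 * ((k : ℂ) / m) ^ 2 ∧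
      ∃ C : ℂ, C ≠ 0 ∧ Tendsto (fun z ↦ deriv H z * Function.Periodic.qParam m z ^ (-k))
        (comap Complex.im atTop) (𝓝 C) := by
  have hmR : (0 : ℝ) < m := by exact_mod_cast hm
  have hmC : (m : ℂ) ≠ 0 := by exact_mod_cast hm.ne'
  set q : ℂ → ℂ := Function.Periodic.qParam m with hq
  have hq0 : ∀ z, q z ≠ 0 := fun z ↦ Function.Periodic.qParam_ne_zero z
  have hqt : Tendsto q (comap Complex.im atTop) (𝓝[≠] 0) := Function.Periodic.qParam_tendsto hmR
  have hqc : Continuous q := Function.Periodic.continuous_qParam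
  set c : ℂ := 2 * Real.pi * Complex.I / m with hc
  have hc0 : c ≠ 0 := by simp [hc, hmC, Complex.I_ne_zero, Real.pi_ne_zero]
  have hlift : ∀ P : ℂ → Prop, (∀ᶠ w in 𝓝[≠] (0 : ℂ), P w) →
      ∀ᶠ z in comap Complex.im atTop, ∀ᶠ z' in 𝓝 z, 0 < z'.im ∧ P (q z') := by
    intro P hP
    have h1 := hqt.eventually (eventually_eventually_nhdsNE hP)
    have h2 : ∀ᶠ z : ℂ in comap Complex.im atTop, 0 < z.im :=
      tendsto_comap.eventually (eventually_gt_atTop 0)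
    filter_upwards [h1, h2] with z hz hz'
    have h3 : ∀ᶠ w : ℂ in 𝓝 z, 0 < w.im :=
      (isOpen_lt continuous_const Complex.continuous_im).mem_nhds hz'
    exact h3.and (hqc.continuousAt.eventually hz)
  have hderivH : ∀ᶠ w in 𝓝[≠] (0 : ℂ), AnalyticAt ℂ F₀ w := hF.eventually_analyticAt
  have hD : MeromorphicAt (deriv F₀) 0 := hF.deriv
  have hHd : ∀ z : ℂ, 0 < z.im → AnalyticAt ℂ F₀ (q z) → deriv H z = deriv F₀ (q z) * (c * q z) := by
    intro z hz hz'
    have h3 : ∀ᶠ w : ℂ in 𝓝 z, 0 < w.im :=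
      (isOpen_lt continuous_const Complex.continuous_im).mem_nhds hz
    have h1 : H =ᶠ[𝓝 z] F₀ ∘ q := h3.mono fun w hw ↦ hH w hw
    rw [h1.deriv_eq]
    exact (hz'.differentiableAt.hasDerivAt.comp z (hasDerivAt_qParam m z)).deriv
  have hne : meromorphicOrderAt (deriv F₀) 0 ≠ ⊤ := by
    intro htop
    rw [meromorphicOrderAt_eq_top_iff] at htop
    have h1 : ∀ᶠ z in comap Complex.im atTop, schwarzDeriv H z = 0 := by
      filter_upwards [hlift _ (htop.and hderivH)] with z hz
      refine schwarzDeriv_eq_zero ?_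
      filter_upwards [hz] with w ⟨hw, hw1, hw2⟩
      rw [hHd w hw hw2, hw1, zero_mul]
    have h2 : Tendsto (schwarzDeriv H) (comap Complex.im atTop) (𝓝 0) :=
      tendsto_const_nhds.congr' (h1.mono fun _ h ↦ h.symm)
    exact he (eq_of_tendsto_of_frequently_eq h2 hE hS).symm
  obtain ⟨l, hl⟩ := WithTop.ne_top_iff_exists.mp hne
  obtain ⟨g, hg, hgp, hDg⟩ := (meromorphicOrderAt_eq_int_iff hD).mp hl.symm
  -- This correction to the logarithmic derivative of `H'` vanishes at `0`, so only the exponent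
  -- survives in the limit.
  set v : ℂ → ℂ := fun w ↦ w * (deriv g w / g w) with hv
  have hva : AnalyticAt ℂ v 0 := analyticAt_id.mul (hg.deriv.div hg hgp)
  have hev : ∀ᶠ w in 𝓝[≠] (0 : ℂ), AnalyticAt ℂ F₀ w ∧ AnalyticAt ℂ g w ∧ g w ≠ 0 ∧
      AnalyticAt ℂ v w ∧ deriv F₀ w = w ^ l * g w := by
    filter_upwards [hderivH, hg.eventually_analyticAt.filter_mono nhdsWithin_le_nhds,
      (hg.continuousAt.eventually_ne hgp).filter_mono nhdsWithin_le_nhds,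
      hva.eventually_analyticAt.filter_mono nhdsWithin_le_nhds, hDg] with w h1 h2 h3 h4 h5
    exact ⟨h1, h2, h3, h4, by simpa using h5⟩
  have hevH := hlift _ hev
  have hHform : ∀ w : ℂ, 0 < w.im → (AnalyticAt ℂ F₀ (q w) ∧ AnalyticAt ℂ g (q w) ∧ g (q w) ≠ 0 ∧
      AnalyticAt ℂ v (q w) ∧ deriv F₀ (q w) = q w ^ l * g (q w)) →
      deriv H w = c * (q w ^ (l + 1) * g (q w)) := by
    rintro w hw ⟨h1, -, -, -, h5⟩
    rw [hHd w hw h1, h5, zpow_add_one₀ (hq0 w)]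
    ring
  have hSform : ∀ᶠ z in comap Complex.im atTop, schwarzDeriv H z =
      c * (deriv v (q z) * (c * q z)) - 1 / 2 * (c * ((l + 1 : ℤ) + v (q z))) ^ 2 := by
    filter_upwards [hevH] with z hz
    have hlog : ∀ᶠ w in 𝓝 z, deriv (deriv H) w / deriv H w = c * ((l + 1 : ℤ) + v (q w)) := by
      filter_upwards [hz, hz.eventually_nhds] with w ⟨hw0, hw⟩ hw'
      have h1 : deriv H =ᶠ[𝓝 w] fun w ↦ c * (q w ^ (l + 1) * g (q w)) :=
        hw'.mono fun x hx ↦ hHform x hx.1 hx.2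
      have h2 : HasDerivAt (fun w ↦ q w ^ (l + 1))
          ((l + 1 : ℤ) * q w ^ (l + 1 - 1) * (c * q w)) w :=
        (hasDerivAt_zpow (l + 1) (q w) (.inl (hq0 w))).comp w (hasDerivAt_qParam m w)
      have h3 : HasDerivAt (fun w ↦ g (q w)) (deriv g (q w) * (c * q w)) w :=
        hw.2.1.differentiableAt.hasDerivAt.comp w (hasDerivAt_qParam m w)
      have h7 : HasDerivAt (fun w ↦ c * (q w ^ (l + 1) * g (q w))) (c * (((l + 1 : ℤ) *
          q w ^ (l + 1 - 1) * (c * q w)) * g (q w) + q w ^ (l + 1) * (deriv g (q w) * (c * q w)))) w :=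
        (h2.mul h3).const_mul c
      rw [h1.deriv_eq, h7.deriv, hHform w hw0 hw, hv,
        zpow_sub_one₀ (hq0 w)]
      have h4 := zpow_ne_zero (l + 1) (hq0 w)
      have h5 := hq0 w
      have h6 := hw.2.2.1
      field_simp
    have hder : HasDerivAt (fun w ↦ c * ((l + 1 : ℤ) + v (q w))) (c * (deriv v (q z) * (c * q z))) z :=
      ((hz.self_of_nhds.2.2.2.2.1.differentiableAt.hasDerivAt.comp z
        (hasDerivAt_qParam m z)).const_add _).const_mul c
    rw [schwarzDeriv_eq hlog hder]
  have hqt0 : Tendsto q (comap Complex.im atTop) (𝓝 0) := hqt.mono_right nhdsWithin_le_nhds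
  have hlim : Tendsto (schwarzDeriv H) (comap Complex.im atTop)
      (𝓝 (c * (deriv v 0 * (c * 0)) - 1 / 2 * (c * ((l + 1 : ℤ) + v 0)) ^ 2)) := by
    refine Tendsto.congr' (hSform.mono fun _ h ↦ h.symm) ?_
    exact ((((hva.deriv.continuousAt.tendsto.comp hqt0).mul (hqt0.const_mul c)).const_mul c).sub
      (((((hva.continuousAt.tendsto.comp hqt0).const_add _).const_mul c).pow 2).const_mul _))
  have he' := eq_of_tendsto_of_frequently_eq hlim hE hS
  have hv0 : v 0 = 0 := by simp [hv]
  -- The chain rule `H' = c * q * F₀'(q)` raises the exponent from `l` to `l + 1`. Since `c =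
  -- 2πi/m`, the limit `-(c (l + 1)) ^ 2 / 2` equals `2π² ((l + 1) / m) ^ 2`.
  refine ⟨l + 1, ?_, ?_, c * g 0, mul_ne_zero hc0 hgp, ?_⟩
  · constructor
    · intro hneg
      obtain ⟨k, hk⟩ := WithTop.ne_top_iff_exists.mp (ne_top_of_lt hneg)
      rw [← hk] at hneg
      have hk0 : k < 0 := by exact_mod_cast hneg
      have h1 := meromorphicOrderAt_deriv_eq_sub_one (n := k) (by exact_mod_cast hk0.ne) hk.symm
      rw [← hl] at h1
      have : l = k - 1 := by exact_mod_cast h1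
      omega
    · intro hk
      by_contra hneg
      obtain ⟨G, hG, hFG⟩ := hF.meromorphicOrderAt_nonneg_iff.mp (not_lt.mp hneg)
      have h1 : deriv F₀ =ᶠ[𝓝[≠] 0] deriv G :=
        (eventually_eventually_nhdsNE hFG).mono fun z hz ↦ EventuallyEq.deriv_eq hz
      have h2 : 0 ≤ meromorphicOrderAt (deriv F₀) 0 := by
        rw [meromorphicOrderAt_congr h1]
        exact hG.deriv.meromorphicOrderAt_nonneg
      rw [← hl] at h2
      have : 0 ≤ l := by exact_mod_cast h2
      omega
  · rw [← he', hv0, hc]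
    field_simp
    ring_nf
    simp
  · have h1 : Tendsto (fun z ↦ c * g (q z)) (comap Complex.im atTop) (𝓝 (c * g 0)) :=
      (hg.continuousAt.tendsto.comp hqt0).const_mul c
    refine h1.congr' ?_
    filter_upwards [hevH] with z hz
    have hz' := hz.self_of_nhds
    rw [hHform z hz'.1 hz'.2, zpow_neg]
    have h4 := zpow_ne_zero (l + 1) (hq0 z)
    field_simp

end ModularSchwarz

namespace ModularSchwarz
open Filter Topology Manifold

/-! ### Translates of functions on the upper half-plane -/

lemma det_SL_coe (γ : SL(2, ℤ)) : ((γ : GL (Fin 2) ℝ)).val.det = 1 :=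
  (Matrix.SpecialLinearGroup.map (Int.castRingHom ℝ) γ).det_coe

lemma det_SL_coe_pos (γ : SL(2, ℤ)) : 0 < ((γ : GL (Fin 2) ℝ)).val.det :=
  (det_SL_coe γ).symm ▸ one_pos

lemma hasDerivAt_SL_smul (γ : SL(2, ℤ)) (τ : ℍ) :
    HasDerivAt (fun z ↦ ((γ • ofComplex z : ℍ) : ℂ)) (1 / denom γ τ ^ 2) τ := by
  have := (UpperHalfPlane.hasStrictDerivAt_smul (det_SL_coe_pos γ) τ).hasDerivAt
  rw [det_SL_coe] at this
  exact_mod_cast this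

lemma denom_SL_eq (γ : SL(2, ℤ)) (z : ℂ) : denom γ z = (γ 1 0 : ℂ) * z + γ 1 1 := by
  simp [denom]

/-- The derivative of the translate `τ ↦ h (γ • τ)`. -/
noncomputable def translateDeriv (h : ℍ → ℂ) (γ : SL(2, ℤ)) (τ : ℍ) : ℂ :=
  deriv ((fun σ : ℍ ↦ h (γ • σ)) ∘ ofComplex) τ

lemma comp_smul_eq (f : ℍ → ℂ) (γ : SL(2, ℤ)) :
    (fun σ : ℍ ↦ f (γ • σ)) ∘ ofComplex =
      (f ∘ ofComplex) ∘ fun z ↦ ((γ • ofComplex z : ℍ) : ℂ) := by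
  ext z; simp

/-- No differentiability is needed: translating back by `γ⁻¹` shows that both sides are
differentiable together, and otherwise both derivatives are `0`. -/
lemma deriv_comp_smul (f : ℍ → ℂ) (γ : SL(2, ℤ)) (τ : ℍ) :
    deriv ((fun σ : ℍ ↦ f (γ • σ)) ∘ ofComplex) τ =
      deriv (f ∘ ofComplex) ((γ • τ : ℍ) : ℂ) / denom γ τ ^ 2 := by
  have key (f : ℍ → ℂ) (γ : SL(2, ℤ)) (τ : ℍ)
      (hf : DifferentiableAt ℂ (f ∘ ofComplex) ((γ • τ : ℍ) : ℂ)) :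
      HasDerivAt ((fun σ : ℍ ↦ f (γ • σ)) ∘ ofComplex)
        (deriv (f ∘ ofComplex) ((γ • τ : ℍ) : ℂ) * (1 / denom γ τ ^ 2)) τ := by
    rw [comp_smul_eq]
    refine HasDerivAt.comp (τ : ℂ) ?_ (hasDerivAt_SL_smul γ τ)
    simpa using hf.hasDerivAt
  by_cases hf : DifferentiableAt ℂ (f ∘ ofComplex) ((γ • τ : ℍ) : ℂ)
  · rw [(key f γ τ hf).deriv, mul_one_div]
  · rw [deriv_zero_of_not_differentiableAt hf, zero_div, deriv_zero_of_not_differentiableAt]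
    intro hd
    refine hf ?_
    have h1 := (key (fun σ ↦ f (γ • σ)) γ⁻¹ (γ • τ) (by simpa using hd)).differentiableAt
    simpa using h1

lemma translateDeriv_smul (h : ℍ → ℂ) (γ δ : SL(2, ℤ)) (τ : ℍ) :
    translateDeriv h γ (δ • τ) = denom δ τ ^ 2 * translateDeriv h (γ * δ) τ := by
  have h1 := deriv_comp_smul (fun σ ↦ h (γ • σ)) δ τ
  have h2 : translateDeriv h (γ * δ) τ = translateDeriv h γ (δ • τ) / denom δ τ ^ 2 := by
    simpa only [translateDeriv, mul_smul] using h1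
  rw [h2]
  field_simp [denom_ne_zero]

lemma hasDerivAt_denom (γ : SL(2, ℤ)) (z : ℂ) : HasDerivAt (denom γ) ((γ 1 0 : ℤ) : ℂ) z := by
  have : HasDerivAt (fun z ↦ (γ 1 0 : ℂ) * z + γ 1 1) ((γ 1 0 : ℂ) * 1) z :=
    ((hasDerivAt_id z).const_mul _).add_const _
  rw [mul_one] at this
  exact this.congr_of_eventuallyEq (.of_forall fun z ↦ denom_SL_eq γ z)

/-- Composition with `γ` adds `-2c / denom` to the logarithmic derivative. Its contributions cancel
because a Möbius map has Schwarzian zero, leaving weight 4. -/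
lemma schwarzDeriv_comp_smul (f : ℍ → ℂ) (γ : SL(2, ℤ)) (τ : ℍ)
    (hf : AnalyticAt ℂ (f ∘ ofComplex) ((γ • τ : ℍ) : ℂ))
    (hf' : deriv (f ∘ ofComplex) ((γ • τ : ℍ) : ℂ) ≠ 0) :
    schwarzDeriv ((fun σ : ℍ ↦ f (γ • σ)) ∘ ofComplex) τ =
      schwarzDeriv (f ∘ ofComplex) ((γ • τ : ℍ) : ℂ) / denom γ τ ^ 4 := by
  set F := f ∘ ofComplex with hF
  set G : ℂ → ℂ := fun z ↦ ((γ • ofComplex z : ℍ) : ℂ) with hG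
  have hGτ : G τ = ((γ • τ : ℍ) : ℂ) := by simp [hG]
  set A : ℂ → ℂ := fun w ↦ deriv (deriv F) w / deriv F w with hA
  set c : ℂ := ((γ 1 0 : ℤ) : ℂ) with hc
  have hAan : AnalyticAt ℂ A ((γ • τ : ℍ) : ℂ) := hf.deriv.deriv.div hf.deriv hf'
  have hGd (z : ℍ) : HasDerivAt G (1 / denom γ z ^ 2) z := hasDerivAt_SL_smul γ z
  have hev : ∀ᶠ z in 𝓝 (τ : ℂ), 0 < z.im ∧ AnalyticAt ℂ F (G z) ∧ deriv F (G z) ≠ 0 := by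
    have h1 : ∀ᶠ z in 𝓝 (τ : ℂ), 0 < z.im := isOpen_upperHalfPlaneSet.mem_nhds τ.im_pos
    have h2 : ContinuousAt G τ := (hGd τ).continuousAt
    have h3 : ∀ᶠ w in 𝓝 (G τ), AnalyticAt ℂ F w ∧ deriv F w ≠ 0 := by
      rw [hGτ]
      exact hf.eventually_analyticAt.and (hf.deriv.continuousAt.eventually_ne hf')
    exact h1.and (h2.eventually h3)
  have hlog : ∀ᶠ z in 𝓝 (τ : ℂ), deriv (deriv ((fun σ : ℍ ↦ f (γ • σ)) ∘ ofComplex)) z /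
      deriv ((fun σ : ℍ ↦ f (γ • σ)) ∘ ofComplex) z =
      A (G z) / denom γ z ^ 2 - 2 * c / denom γ z := by
    have hd : ∀ z : ℂ, 0 < z.im → deriv ((fun σ : ℍ ↦ f (γ • σ)) ∘ ofComplex) z =
        deriv F (G z) / denom γ z ^ 2 := by
      intro z hz
      have := deriv_comp_smul f γ ⟨z, hz⟩
      simpa [hG, ofComplex_apply_of_im_pos hz] using! this
    filter_upwards [hev] with z ⟨hz, hz1, hz2⟩
    have hz0 : denom γ z ≠ 0 := denom_ne_zero γ ⟨z, hz⟩
    have h1 : deriv ((fun σ : ℍ ↦ f (γ • σ)) ∘ ofComplex) =ᶠ[𝓝 z]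
        fun z ↦ deriv F (G z) / denom γ z ^ 2 := by
      have : ∀ᶠ w in 𝓝 z, 0 < w.im := isOpen_upperHalfPlaneSet.mem_nhds hz
      exact this.mono hd
    have h2 : HasDerivAt (fun z ↦ deriv F (G z) / denom γ z ^ 2)
        ((deriv (deriv F) (G z) * (1 / denom γ z ^ 2) * denom γ z ^ 2 -
          deriv F (G z) * (2 * denom γ z ^ (2 - 1) * c)) / (denom γ z ^ 2) ^ 2) z := by
      have h3 : HasDerivAt (fun z ↦ deriv F (G z)) (deriv (deriv F) (G z) * (1 / denom γ z ^ 2)) z :=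
        hz1.deriv.differentiableAt.hasDerivAt.comp z (hGd ⟨z, hz⟩)
      have h4 : HasDerivAt (fun z ↦ denom γ z ^ 2) (2 * denom γ z ^ (2 - 1) * c) z := by
        simpa using (hasDerivAt_denom γ z).fun_pow 2
      exact h3.fun_div h4 (pow_ne_zero 2 hz0)
    rw [h1.deriv_eq, h2.deriv, hd z hz, hA]
    field_simp
    ring
  have hτ0 : denom γ τ ≠ 0 := denom_ne_zero γ τ
  have hder : HasDerivAt (fun z ↦ A (G z) / denom γ z ^ 2 - 2 * c / denom γ z)
      (((deriv A (G τ) * (1 / denom γ τ ^ 2)) * denom γ τ ^ 2 -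
        A (G τ) * (2 * denom γ τ ^ (2 - 1) * c)) / (denom γ τ ^ 2) ^ 2 -
        (0 * denom γ τ - 2 * c * c) / denom γ τ ^ 2) (τ : ℂ) := by
    have h3 : HasDerivAt (fun z ↦ A (G z)) (deriv A (G τ) * (1 / denom γ τ ^ 2)) τ := by
      have h5 : HasDerivAt A (deriv A (G τ)) (G τ) := by
        rw [hGτ]
        exact hAan.differentiableAt.hasDerivAt
      exact h5.comp (τ : ℂ) (hGd τ)
    have h4 : HasDerivAt (fun z ↦ denom γ z ^ 2) (2 * denom γ τ ^ (2 - 1) * c) τ := by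
      simpa using (hasDerivAt_denom γ τ).fun_pow 2
    exact (h3.fun_div h4 (pow_ne_zero 2 hτ0)).sub
      ((hasDerivAt_const _ _).fun_div (hasDerivAt_denom γ τ) hτ0)
  rw [schwarzDeriv_eq hlog hder, schwarzDeriv, ← hGτ]
  change _ = (deriv A (G τ) - 1 / 2 * (A (G τ)) ^ 2) / _
  field_simp
  ring

lemma tendsto_SL_smul_nhdsNE (γ : SL(2, ℤ)) (τ : ℍ) :
    Tendsto (fun z ↦ ((γ • ofComplex z : ℍ) : ℂ)) (𝓝[≠] (τ : ℂ)) (𝓝[≠] ((γ • τ : ℍ) : ℂ)) := by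
  have h1 := hasDerivAt_SL_smul γ τ
  have := h1.tendsto_nhdsNE (one_div_ne_zero (pow_ne_zero 2 (denom_ne_zero γ τ)))
  simpa using this

lemma not_eventually_E₄_eq_zero (τ : ℍ) :
    ¬ ∀ᶠ z in 𝓝[≠] (τ : ℂ), ModularForm.E₄ (ofComplex z) = 0 := by
  intro h
  have h1 : ∀ᶠ z in 𝓝[≠] τ, ModularForm.E₄ z = 0 := by
    have h2 : Tendsto UpperHalfPlane.coe (𝓝[≠] τ) (𝓝[≠] (τ : ℂ)) :=
      tendsto_nhdsWithin_of_tendsto_nhds_of_eventually_within _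
        (continuous_coe.continuousAt.tendsto.mono_left nhdsWithin_le_nhds)
        (eventually_nhdsWithin_of_forall fun z hz h ↦ hz (UpperHalfPlane.ext h))
    simpa using h2.eventually h
  have : (𝓝[≠] τ).NeBot := by
    have := isOpenEmbedding_coe.isOpenMap
    rw [← mem_closure_iff_nhdsWithin_neBot, (dense_compl_singleton_iff_not_open.mpr ?_).closure_eq]
    · trivial
    · intro ho
      have h3 := this _ ho
      rw [Set.image_singleton] at h3
      exact not_isOpen_singleton _ h3
  have h2 := UpperHalfPlane.eq_zero_of_frequently mdiff_E₄ h1.frequently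
  have h3 := tendsto_E₄_atImInfty
  rw [h2] at h3
  exact one_ne_zero (tendsto_nhds_unique h3 tendsto_const_nhds)

variable {m n : ℕ} {h : ℍ → ℂ}

lemma IsModularFunction.meromorphicAt (hmod : IsModularFunction m h) (τ : ℍ) :
    MeromorphicAt (h ∘ ofComplex) τ :=
  (hmod.meromorphic τ.im_pos).meromorphicAt

lemma IsModularFunction.meromorphicAt_translate (hmod : IsModularFunction m h) (γ : SL(2, ℤ))
    (τ : ℍ) : MeromorphicAt ((fun σ : ℍ ↦ h (γ • σ)) ∘ ofComplex) τ := by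
  rw [comp_smul_eq]
  refine MeromorphicAt.comp_analyticAt ?_ (UpperHalfPlane.analyticAt_smul (det_SL_coe_pos γ) τ)
  simpa using hmod.meromorphicAt (γ • τ)

lemma IsSchwarzSolution.eventually (hsol : IsSchwarzSolution m n h) (τ : ℍ) :
    ∀ᶠ z in 𝓝[≠] (τ : ℂ), schwarzDeriv (h ∘ ofComplex) z =
      2 * (Real.pi : ℂ) ^ 2 * ((n : ℂ) / (m : ℂ)) ^ 2 * ModularForm.E₄ (ofComplex z) := by
  have h1 := mem_codiscreteWithin_iff_forall_mem_nhdsNE.mp hsol τ τ.im_pos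
  have h2 : ∀ᶠ z in 𝓝[≠] (τ : ℂ), 0 < z.im :=
    nhdsWithin_le_nhds (isOpen_upperHalfPlaneSet.mem_nhds τ.im_pos)
  filter_upwards [h1, h2] with z hz hz'
  exact hz.resolve_right fun h ↦ h hz'

lemma constant_ne_zero (hm : 0 < m) (hn : 0 < n) :
    2 * (Real.pi : ℂ) ^ 2 * ((n : ℂ) / (m : ℂ)) ^ 2 ≠ 0 := by
  have : (m : ℂ) ≠ 0 := by exact_mod_cast hm.ne'
  have : (n : ℂ) ≠ 0 := by exact_mod_cast hn.ne'
  have : (Real.pi : ℂ) ≠ 0 := by exact_mod_cast Real.pi_ne_zero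
  exact mul_ne_zero (mul_ne_zero two_ne_zero (pow_ne_zero 2 this))
    (pow_ne_zero 2 (div_ne_zero ‹_› ‹_›))

/-- The factor `denom ^ 4` of `E₄` cancels that of the Schwarzian, so all translates satisfy one and
the same equation. -/
lemma eventually_schwarzDeriv_translate (hm : 0 < m) (hn : 0 < n) (hmod : IsModularFunction m h)
    (hsol : IsSchwarzSolution m n h) (γ : SL(2, ℤ)) (τ : ℍ) :
    ∀ᶠ z in 𝓝[≠] (τ : ℂ), schwarzDeriv ((fun σ : ℍ ↦ h (γ • σ)) ∘ ofComplex) z =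
      2 * (Real.pi : ℂ) ^ 2 * ((n : ℂ) / (m : ℂ)) ^ 2 * ModularForm.E₄ (ofComplex z) := by
  have hmer := hmod.meromorphicAt (γ • τ)
  have hne : ∀ᶠ w in 𝓝[≠] ((γ • τ : ℍ) : ℂ), deriv (h ∘ ofComplex) w ≠ 0 := by
    refine hmer.deriv.eventually_eq_zero_or_eventually_ne_zero.resolve_left fun h0 ↦ ?_
    refine not_eventually_E₄_eq_zero (γ • τ) ?_
    filter_upwards [eventually_eventually_nhdsNE h0, hsol.eventually (γ • τ)] with w hw hw'
    rw [schwarzDeriv_eq_zero hw] at hw'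
    exact (mul_eq_zero.mp hw'.symm).resolve_left (constant_ne_zero hm hn)
  have hT := tendsto_SL_smul_nhdsNE γ τ
  have h2 : ∀ᶠ z in 𝓝[≠] (τ : ℂ), 0 < z.im :=
    nhdsWithin_le_nhds (isOpen_upperHalfPlaneSet.mem_nhds τ.im_pos)
  filter_upwards [h2, hT.eventually hne, hT.eventually (hsol.eventually (γ • τ)),
    hT.eventually hmer.eventually_analyticAt] with z hz h3 h4 h5
  lift z to ℍ using hz
  simp only [ofComplex_apply] at h3 h4 h5 ⊢
  rw [schwarzDeriv_comp_smul h γ z h5 h3, h4, E₄_smul]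
  have := denom_ne_zero γ z
  field_simp

lemma order_translateDeriv (hm : 0 < m) (hn : 0 < n) (hmod : IsModularFunction m h)
    (hsol : IsSchwarzSolution m n h) (γ : SL(2, ℤ)) (τ : ℍ) [Decidable (HasPoleAt h (γ • τ))] :
    meromorphicOrderAt (translateDeriv h γ ∘ ofComplex) τ =
      ((if HasPoleAt h (γ • τ) then -2 else 0 : ℤ)) := by
  have h1 : translateDeriv h γ ∘ ofComplex =ᶠ[𝓝[≠] (τ : ℂ)]
      deriv ((fun σ : ℍ ↦ h (γ • σ)) ∘ ofComplex) := by
    have h2 : ∀ᶠ z in 𝓝[≠] (τ : ℂ), 0 < z.im :=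
      nhdsWithin_le_nhds (isOpen_upperHalfPlaneSet.mem_nhds τ.im_pos)
    filter_upwards [h2] with z hz
    simp [translateDeriv, ofComplex_apply_of_im_pos hz]
  have hE : ContinuousAt (fun z ↦ 2 * (Real.pi : ℂ) ^ 2 * ((n : ℂ) / (m : ℂ)) ^ 2 *
      ModularForm.E₄ (ofComplex z)) τ :=
    (analyticAt_of_mdiff mdiff_E₄ τ.im_pos).continuousAt.const_mul _
  rw [meromorphicOrderAt_congr h1, order_deriv_of_schwarzDeriv (hmod.meromorphicAt_translate γ τ) hE
    ?_ (eventually_schwarzDeriv_translate hm hn hmod hsol γ τ)]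
  · have h3 : meromorphicOrderAt ((fun σ : ℍ ↦ h (γ • σ)) ∘ ofComplex) τ =
        meromorphicOrderAt (h ∘ ofComplex) ((γ • τ : ℍ) : ℂ) :=
      UpperHalfPlane.meromorphicOrderAt_comp_smul (f := h) (τ := τ) (det_SL_coe_pos γ)
    rw [h3]
    simp only [HasPoleAt]
    congr
  · intro h0
    refine not_eventually_E₄_eq_zero τ (h0.mono fun z hz ↦ ?_)
    exact (mul_eq_zero.mp hz).resolve_left (constant_ne_zero hm hn)

end ModularSchwarz

namespace ModularSchwarz
open Filter Topology Manifold CongruenceSubgroup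

/-! ### Behaviour at the cusps -/

lemma tendsto_qParam_atImInfty {m : ℕ} (hm : 0 < m) :
    Tendsto (fun τ : ℍ ↦ Function.Periodic.qParam m τ) atImInfty (𝓝 0) :=
  UpperHalfPlane.qParam_tendsto_atImInfty (by exact_mod_cast hm)

lemma exponent_unique {m : ℕ} (hm : 0 < m) {f : ℍ → ℂ} {k k' : ℤ} {C C' : ℂ} (hC : C ≠ 0)
    (hC' : C' ≠ 0)
    (h : Tendsto (fun τ : ℍ ↦ f τ * Function.Periodic.qParam m τ ^ (-k)) atImInfty (𝓝 C))
    (h' : Tendsto (fun τ : ℍ ↦ f τ * Function.Periodic.qParam m τ ^ (-k')) atImInfty (𝓝 C')) :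
    k = k' := by
  wlog hlt : k < k' generalizing k k' C C'
  · rcases eq_or_lt_of_le (not_lt.mp hlt) with h1 | h1
    · exact h1.symm
    · exact (this hC' hC h' h h1).symm
  exfalso
  obtain ⟨d, hd⟩ := Int.eq_ofNat_of_zero_le (sub_nonneg.mpr hlt.le)
  have hd0 : d ≠ 0 := by rintro rfl; simp at hd; omega
  have h1 := h'.mul ((tendsto_qParam_atImInfty hm).pow d)
  rw [zero_pow hd0, mul_zero] at h1
  refine hC (tendsto_nhds_unique (h.congr fun τ ↦ ?_) h1)
  have hq : Function.Periodic.qParam m (τ : ℂ) ≠ 0 := Function.Periodic.qParam_ne_zero _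
  rw [mul_assoc, ← zpow_natCast, ← zpow_add₀ hq, show -k = -k' + (d : ℤ) by omega]

variable {m n : ℕ} {h : ℍ → ℂ}

lemma IsModularFunction.smul_mul_left (hmod : IsModularFunction m h) {N : SL(2, ℤ)}
    (hN : N ∈ Gamma m) (γ : SL(2, ℤ)) :
    (fun τ : ℍ ↦ h ((N * γ) • τ)) = fun τ ↦ h (γ • τ) := by
  ext τ
  rw [mul_smul, hmod.invariant N hN]

lemma IsModularFunction.smul_mul_right (hmod : IsModularFunction m h) {N : SL(2, ℤ)}
    (hN : N ∈ Gamma m) (γ : SL(2, ℤ)) :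
    (fun τ : ℍ ↦ h ((γ * N) • τ)) = fun τ ↦ h (γ • τ) := by
  rw [← hmod.smul_mul_left ((instNormalGamma m).conj_mem N hN γ) γ]
  simp

lemma IsModularFunction.periodic (hmod : IsModularFunction m h) (γ : SL(2, ℤ)) :
    Function.Periodic ((fun τ : ℍ ↦ h (γ • τ)) ∘ ofComplex) (m : ℝ) := by
  intro z
  by_cases hz : 0 < z.im
  · have hT : ModularGroup.T ^ (m : ℤ) ∈ Gamma m := by
      simpa using ModularGroup_T_pow_mem_Gamma (m : ℤ) m dvd_rfl
    have h1 := congrFun (hmod.smul_mul_right hT γ) ⟨z, hz⟩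
    have h2 : ofComplex (z + (m : ℝ)) = ModularGroup.T ^ (m : ℤ) • (⟨z, hz⟩ : ℍ) := by
      ext
      rw [ModularGroup.coe_T_zpow_smul_eq, ofComplex_apply_of_im_pos (by simpa using hz)]
      simp
    simp only [Function.comp_apply, h2, ofComplex_apply_of_im_pos hz]
    rw [← mul_smul]
    exact h1
  · have h1 : ofComplex (z + (m : ℝ)) = ofComplex z := by
      rw [ofComplex_apply_of_im_nonpos (not_lt.mp hz),
        ofComplex_apply_of_im_nonpos (by simpa using not_lt.mp hz)]
    simp only [Function.comp_apply, h1]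

/-- Since `E₄ → 1`, the exponent `k` satisfies `k ^ 2 = n ^ 2`, and its sign is negative exactly at
a pole. -/
lemma exists_cusp_asymptotics (hm : 0 < m) (hn : 0 < n) (hmod : IsModularFunction m h)
    (hsol : IsSchwarzSolution m n h) (γ : SL(2, ℤ))
    [Decidable (meromorphicOrderAt (cuspExpansion m h γ) 0 < 0)] :
    ∃ C : ℂ, C ≠ 0 ∧ Tendsto (fun τ : ℍ ↦ translateDeriv h γ τ * Function.Periodic.qParam m τ ^
      (-(if meromorphicOrderAt (cuspExpansion m h γ) 0 < 0 then -(n : ℤ) else n)))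
      atImInfty (𝓝 C) := by
  have hm0 : (m : ℂ) ≠ 0 := by exact_mod_cast hm.ne'
  have hF (z : ℂ) (hz : 0 < z.im) : ((fun τ : ℍ ↦ h (γ • τ)) ∘ ofComplex) z =
      cuspExpansion m h γ (Function.Periodic.qParam m z) := by
    have := UpperHalfPlane.eq_cuspFunction (⟨z, hz⟩ : ℍ) (by exact_mod_cast hm.ne')
      (hmod.periodic γ)
    simp only [Function.comp_apply, ofComplex_apply_of_im_pos hz]
    exact this.symm
  have hE : Tendsto (fun z ↦ 2 * (Real.pi : ℂ) ^ 2 * ((n : ℂ) / (m : ℂ)) ^ 2 *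
      ModularForm.E₄ (ofComplex z)) (comap Complex.im atTop)
      (𝓝 (2 * (Real.pi : ℂ) ^ 2 * ((n : ℂ) / (m : ℂ)) ^ 2)) := by
    simpa using (tendsto_E₄_atImInfty.comp tendsto_comap_im_ofComplex).const_mul
      (2 * (Real.pi : ℂ) ^ 2 * ((n : ℂ) / (m : ℂ)) ^ 2)
  have hfreq : ∃ᶠ z in comap Complex.im atTop,
      schwarzDeriv ((fun σ : ℍ ↦ h (γ • σ)) ∘ ofComplex) z =
        2 * (Real.pi : ℂ) ^ 2 * ((n : ℂ) / (m : ℂ)) ^ 2 * ModularForm.E₄ (ofComplex z) := by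
    intro hev
    obtain ⟨A, -, hA⟩ := (atTop_basis.comap Complex.im).eventually_iff.mp hev
    set τ : ℍ := ⟨(|A| + 1 : ℝ) * Complex.I, by simp; positivity⟩ with hτ
    have h1 : ∀ᶠ z in 𝓝[≠] (τ : ℂ), A < z.im := by
      refine nhdsWithin_le_nhds ((isOpen_lt continuous_const Complex.continuous_im).mem_nhds ?_)
      have := le_abs_self A
      simp [hτ]
      linarith
    obtain ⟨z, hz, hz'⟩ :=
      (h1.and (eventually_schwarzDeriv_translate hm hn hmod hsol γ τ)).exists
    exact hA hz.le hz'
  obtain ⟨k, hk, hk2, C, hC, hlim⟩ := exists_exponent_of_schwarzDeriv hm (constant_ne_zero hm hn)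
    (hmod.meromorphic_cusps γ) hF hE hfreq
  refine ⟨C, hC, ?_⟩
  have hk3 : (k : ℂ) ^ 2 = (n : ℂ) ^ 2 := by
    have hpi : (Real.pi : ℂ) ≠ 0 := by exact_mod_cast Real.pi_ne_zero
    field_simp at hk2
    exact hk2.symm
  have hk4 : k ^ 2 = (n : ℤ) ^ 2 := by exact_mod_cast hk3
  have hk5 : (if meromorphicOrderAt (cuspExpansion m h γ) 0 < 0 then -(n : ℤ) else n) = k := by
    rcases sq_eq_sq_iff_eq_or_eq_neg.mp hk4 with h5 | h5
    · rw [if_neg (by rw [hk]; omega), h5]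
    · rw [if_pos (by rw [hk]; omega), h5]
  rw [hk5]
  refine (hlim.comp tendsto_coe_atImInfty).congr fun τ ↦ ?_
  simp [translateDeriv, Function.comp_def]

lemma tendsto_SL_smul_atImInfty {P : SL(2, ℤ)} (hP : P 1 0 = 0) :
    Tendsto (fun τ : ℍ ↦ P • τ) atImInfty atImInfty := by
  refine UpperHalfPlane.tendsto_smul_atImInfty (g := (P : GL (Fin 2) ℝ)) ?_
  simp [hP]

lemma denom_sq_eq_one {P : SL(2, ℤ)} (hP : P 1 0 = 0) (τ : ℍ) : denom P τ ^ 2 = 1 := by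
  have h1 := P.det_coe
  rw [Matrix.det_fin_two, hP, mul_zero, sub_zero] at h1
  have h2 : P 1 1 * P 1 1 = 1 := by
    rcases Int.eq_one_or_neg_one_of_mul_eq_one' h1 with ⟨-, h⟩ | ⟨-, h⟩ <;> rw [h] <;> rfl
  rw [denom_SL_eq, hP, Int.cast_zero, zero_mul, zero_add, sq]
  exact_mod_cast h2

/-- `P = ±T ^ j` only multiplies `q` by the constant `ζ`, so the exponent, whose sign records the
pole, is unchanged. Hence having a pole at a cusp does not depend on the chosen `γ`. -/
lemma pole_cuspExpansion_mul_right (hm : 0 < m) (hn : 0 < n) (hmod : IsModularFunction m h)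
    (hsol : IsSchwarzSolution m n h) (γ : SL(2, ℤ)) {P : SL(2, ℤ)} (hP : P ∈ stabilizerInfty) :
    meromorphicOrderAt (cuspExpansion m h (γ * P)) 0 < 0 ↔
      meromorphicOrderAt (cuspExpansion m h γ) 0 < 0 := by
  classical
  rw [mem_stabilizerInfty] at hP
  obtain ⟨C, hC, hl⟩ := exists_cusp_asymptotics hm hn hmod hsol γ
  obtain ⟨C', hC', hl'⟩ := exists_cusp_asymptotics hm hn hmod hsol (γ * P)
  set k : ℤ := if meromorphicOrderAt (cuspExpansion m h γ) 0 < 0 then -(n : ℤ) else n with hk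
  obtain ⟨j, hj⟩ := ModularGroup.exists_eq_T_zpow_of_c_eq_zero hP
  set ζ := Function.Periodic.qParam m (j : ℂ)
  have hζ : ζ ≠ 0 := Function.Periodic.qParam_ne_zero _
  have hl2 : Tendsto (fun τ : ℍ ↦ translateDeriv h (γ * P) τ * Function.Periodic.qParam m τ ^ (-k))
      atImInfty (𝓝 (C * ζ ^ k)) := by
    refine ((hl.comp (tendsto_SL_smul_atImInfty hP)).mul_const (ζ ^ k)).congr fun τ ↦ ?_
    have hq : Function.Periodic.qParam m ((P • τ : ℍ) : ℂ) = Function.Periodic.qParam m τ * ζ := by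
      rw [hj, ModularGroup.coe_T_zpow_smul_eq]
      simp only [ζ, Function.Periodic.qParam, ← Complex.exp_add, mul_add, add_div]
    simp only [Function.comp_apply]
    rw [translateDeriv_smul, denom_sq_eq_one hP, one_mul, hq, mul_zpow, mul_assoc, mul_assoc,
      ← zpow_add₀ hζ, neg_add_cancel, zpow_zero, mul_one]
  have := exponent_unique hm (mul_ne_zero hC (zpow_ne_zero k hζ)) hC' hl2 hl'
  rw [hk] at this
  clear_value k
  split_ifs at this with h1 h2 h2
  · exact iff_of_true h2 h1
  · omega
  · omega
  · exact iff_of_false h2 h1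

lemma mapGL_smul_infty_eq_iff (γ γ' : SL(2, ℤ)) :
    Matrix.SpecialLinearGroup.mapGL ℝ γ • (OnePoint.infty : OnePoint ℝ) =
      Matrix.SpecialLinearGroup.mapGL ℝ γ' • (OnePoint.infty : OnePoint ℝ) ↔
      γ'⁻¹ * γ ∈ stabilizerInfty := by
  rw [← inv_smul_eq_iff, ← map_inv, ← mul_smul, ← map_mul, mem_stabilizerInfty]
  rw [OnePoint.smul_infty_eq_self_iff]
  generalize γ'⁻¹ * γ = g
  simp

lemma hasPoleAtCusp_iff (hm : 0 < m) (hn : 0 < n) (hmod : IsModularFunction m h)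
    (hsol : IsSchwarzSolution m n h) (γ : SL(2, ℤ)) :
    HasPoleAtCusp m h (Matrix.SpecialLinearGroup.mapGL ℝ γ • (OnePoint.infty : OnePoint ℝ)) ↔
      meromorphicOrderAt (cuspExpansion m h γ) 0 < 0 := by
  constructor
  · rintro ⟨γ', hγ', hpole⟩
    rw [mapGL_smul_infty_eq_iff] at hγ'
    have := pole_cuspExpansion_mul_right hm hn hmod hsol γ hγ'
    rw [mul_inv_cancel_left] at this
    exact this.mp hpole
  · exact fun hp ↦ ⟨γ, rfl, hp⟩

lemma cuspExpansion_mul_left (hmod : IsModularFunction m h) {N : SL(2, ℤ)} (hN : N ∈ Gamma m)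
    (γ : SL(2, ℤ)) : cuspExpansion m h (N * γ) = cuspExpansion m h γ := by
  rw [cuspExpansion, hmod.smul_mul_left hN, cuspExpansion]

/-! ### Finiteness of the set of poles -/

lemma hasPoleAt_smul_iff (γ : SL(2, ℤ)) (τ : ℍ) :
    HasPoleAt h (γ • τ) ↔ HasPoleAt (fun σ ↦ h (γ • σ)) τ := by
  have h3 : meromorphicOrderAt ((fun σ : ℍ ↦ h (γ • σ)) ∘ ofComplex) τ =
      meromorphicOrderAt (h ∘ ofComplex) ((γ • τ : ℍ) : ℂ) :=
    UpperHalfPlane.meromorphicOrderAt_comp_smul (f := h) (τ := τ) (det_SL_coe_pos γ)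
  rw [HasPoleAt, HasPoleAt, h3]

lemma hasPoleAt_smul_of_mem (hmod : IsModularFunction m h) {N : SL(2, ℤ)} (hN : N ∈ Gamma m)
    (τ : ℍ) : HasPoleAt h (N • τ) ↔ HasPoleAt h τ := by
  rw [hasPoleAt_smul_iff]
  have := hmod.smul_mul_left hN 1
  simp only [mul_one, one_smul] at this
  rw [this]

lemma not_hasPoleAt_of_analyticAt {f : ℍ → ℂ} {τ : ℍ} (hf : AnalyticAt ℂ (f ∘ ofComplex) τ) :
    ¬ HasPoleAt f τ :=
  not_lt.mpr hf.meromorphicOrderAt_nonneg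

lemma exists_forall_not_hasPoleAt (hm : 0 < m) (hmod : IsModularFunction m h) (γ : SL(2, ℤ)) :
    ∃ Y : ℝ, ∀ τ : ℍ, Y < τ.im → ¬ HasPoleAt h (γ • τ) := by
  have hmR : (0 : ℝ) < m := by exact_mod_cast hm
  have h1 : ∀ᶠ z in comap Complex.im atTop,
      AnalyticAt ℂ (cuspExpansion m h γ) (Function.Periodic.qParam m z) :=
    (Function.Periodic.qParam_tendsto hmR).eventually
      (hmod.meromorphic_cusps γ).eventually_analyticAt
  obtain ⟨Y, -, hY⟩ := (atTop_basis.comap Complex.im).eventually_iff.mp h1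
  refine ⟨Y, fun τ hτ ↦ ?_⟩
  rw [hasPoleAt_smul_iff]
  refine not_hasPoleAt_of_analyticAt ?_
  have h2 : AnalyticAt ℂ (cuspExpansion m h γ ∘ Function.Periodic.qParam m) (τ : ℂ) := by
    refine (hY hτ.le).comp ?_
    have : Differentiable ℂ (Function.Periodic.qParam (m : ℝ)) :=
      fun z ↦ (hasDerivAt_qParam m z).differentiableAt
    exact this.analyticAt _
  refine h2.congr ?_
  have h3 : ∀ᶠ z in 𝓝 (τ : ℂ), 0 < z.im := isOpen_upperHalfPlaneSet.mem_nhds τ.im_pos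
  filter_upwards [h3] with z hz
  have := UpperHalfPlane.eq_cuspFunction (⟨z, hz⟩ : ℍ) hmR.ne' (hmod.periodic γ)
  simp only [Function.comp_apply, ofComplex_apply_of_im_pos hz]
  exact this

lemma finite_poles_of_isCompact (hmod : IsModularFunction m h) (γ : SL(2, ℤ)) {K : Set ℍ}
    (hK : IsCompact K) : {τ ∈ K | HasPoleAt h (γ • τ)}.Finite := by
  have hloc (τ : ℍ) : {σ : ℍ | σ ≠ τ → ¬ HasPoleAt h (γ • σ)} ∈ 𝓝 τ := by
    have h1 := eventually_nhdsWithin_iff.mp (hmod.meromorphicAt_translate γ τ).eventually_analyticAt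
    have h2 := (continuous_coe.continuousAt (x := τ)).tendsto.eventually h1
    filter_upwards [h2] with σ hσ hne
    rw [hasPoleAt_smul_iff]
    exact not_hasPoleAt_of_analyticAt (hσ fun h ↦ hne (UpperHalfPlane.ext h))
  obtain ⟨t, -, ht⟩ := hK.elim_nhds_subcover _ fun τ _ ↦ hloc τ
  refine t.finite_toSet.subset ?_
  rintro σ ⟨hσ, hp⟩
  obtain ⟨τ, hτ, hστ⟩ := Set.mem_iUnion₂.mp (ht hσ)
  by_contra hne
  exact hστ (fun h ↦ hne (h ▸ hτ)) hp

/-- Finitely many translates of the fundamental domain represent all orbits; in each, meromorphy at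
the cusp bounds the height of the poles and compactness leaves finitely many. -/
lemma finite_interiorPoles (hm : 0 < m) (hmod : IsModularFunction m h) :
    (interiorPoles m h).Finite := by
  have : NeZero m := ⟨hm.ne'⟩
  have : Finite (SL(2, ℤ) ⧸ Gamma m) := Subgroup.finite_quotient_of_finiteIndex
  choose Y hY using fun x : SL(2, ℤ) ⧸ Gamma m ↦ exists_forall_not_hasPoleAt hm hmod x.out
  have hfin : (⋃ x : SL(2, ℤ) ⧸ Gamma m,
      (fun τ ↦ (Quotient.mk _ (x.out • τ) : MulAction.orbitRel.Quotient (Gamma m) ℍ)) ''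
      {τ ∈ ModularGroup.truncatedFundamentalDomain (Y x) | HasPoleAt h (x.out • τ)}).Finite :=
    Set.finite_iUnion fun x ↦ (finite_poles_of_isCompact hmod x.out
      (ModularGroup.isCompact_truncatedFundamentalDomain _)).image _
  refine hfin.subset ?_
  rintro _ ⟨τ, hτ, rfl⟩
  obtain ⟨γ, hγ⟩ := ModularGroup.exists_smul_mem_fd τ
  set x : SL(2, ℤ) ⧸ Gamma m := QuotientGroup.mk γ⁻¹ with hx
  obtain ⟨N, hN⟩ := QuotientGroup.mk_out_eq_mul (Gamma m) γ⁻¹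
  set N' : SL(2, ℤ) := γ⁻¹ * N * γ
  have hN' : N' ∈ Gamma m := by
    simpa [N'] using (instNormalGamma m).conj_mem N N.2 γ⁻¹
  have hxo : x.out • γ • τ = N' • τ := by
    rw [hx, hN, ← mul_smul]
  have hp : HasPoleAt h (x.out • γ • τ) := by
    rw [hxo]
    exact (hasPoleAt_smul_of_mem hmod hN' τ).mpr hτ
  refine Set.mem_iUnion.mpr ⟨x, γ • τ, ⟨⟨hγ, not_lt.mp fun hlt ↦ hY x _ hlt hp⟩, hp⟩, ?_⟩
  simp only [hxo]
  exact Quotient.sound ⟨⟨N', hN'⟩, rfl⟩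

lemma finite_cuspPoles (hm : 0 < m) : (cuspPoles m h).Finite := by
  have : NeZero m := ⟨hm.ne'⟩
  exact Set.toFinite _

end ModularSchwarz

namespace ModularSchwarz
open Filter Topology Manifold
open scoped ModularForm

/-! ### Modular functions of level one without zeros and poles -/

/-- For `K ≥ 0` the function is bounded at `i∞`, so after removing singularities it is a level-one
form of weight 0, a nonzero constant. `K > 0` would force the limit `0`. -/
lemma exponent_eq_zero_of_nonneg {m : ℕ} (hm : 0 < m) {Φ : ℍ → ℂ} {K : ℤ} {C : ℂ}
    (hinv : ∀ (γ : SL(2, ℤ)) (τ : ℍ), Φ (γ • τ) = Φ τ)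
    (hmer : ∀ τ : ℍ, MeromorphicAt (Φ ∘ ofComplex) τ)
    (hord : ∀ τ : ℍ, meromorphicOrderAt (Φ ∘ ofComplex) τ = 0) (hC : C ≠ 0)
    (hlim : Tendsto (fun τ : ℍ ↦ Φ τ * Function.Periodic.qParam m τ ^ (-K)) atImInfty (𝓝 C))
    (hK : 0 ≤ K) : K = 0 := by
  have hmer' : MeromorphicOn (Φ ∘ ofComplex) {z : ℂ | 0 < z.im} := fun z hz ↦ hmer ⟨z, hz⟩
  -- `Φ` may have arbitrary values at removable singularities; the normal form is holomorphic and
  -- nonvanishing, and inherits invariance and bounds from `Φ` by limits.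
  set Ψ : ℂ → ℂ := toMeromorphicNFOn (Φ ∘ ofComplex) {z : ℂ | 0 < z.im} with hΨ
  have hNF (τ : ℍ) : MeromorphicNFAt Ψ τ := meromorphicNFOn_toMeromorphicNFOn _ _ τ.im_pos
  have hordΨ (τ : ℍ) : meromorphicOrderAt Ψ τ = 0 := by
    rw [hΨ, meromorphicOrderAt_toMeromorphicNFOn hmer' τ.im_pos, hord]
  have han (τ : ℍ) : AnalyticAt ℂ Ψ τ :=
    (hNF τ).meromorphicOrderAt_nonneg_iff_analyticAt.mp (hordΨ τ).ge
  have hne (τ : ℍ) : Ψ τ ≠ 0 := (hNF τ).meromorphicOrderAt_eq_zero_iff.mp (hordΨ τ)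
  have heq (τ : ℍ) : ∀ᶠ z in 𝓝[≠] (τ : ℂ), Ψ z = Φ (ofComplex z) :=
    (hmer'.toMeromorphicNFOn_eq_self_on_nhdsNE τ.im_pos).symm.mono fun _ h ↦ h.symm
  -- approximation of `Ψ τ` by values of `Φ`
  have hlimΨ (τ : ℍ) : Tendsto (fun z ↦ Φ (ofComplex z)) (𝓝[≠] (τ : ℂ)) (𝓝 (Ψ τ)) :=
    ((han τ).continuousAt.tendsto.mono_left nhdsWithin_le_nhds).congr' (heq τ)
  have hinvΨ (γ : SL(2, ℤ)) (τ : ℍ) : Ψ ((γ • τ : ℍ) : ℂ) = Ψ τ := by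
    have h1 := (hlimΨ (γ • τ)).comp (tendsto_SL_smul_nhdsNE γ τ)
    refine tendsto_nhds_unique (h1.congr fun z ↦ ?_) (hlimΨ τ)
    simp only [Function.comp_apply, ofComplex_apply]
    exact hinv γ _
  have hbdd : IsBoundedAtImInfty (fun τ : ℍ ↦ Ψ τ) := by
    have h1 : ∀ᶠ τ in atImInfty, ‖Φ τ‖ ≤ ‖C‖ + 1 := by
      obtain ⟨d, hd⟩ := Int.eq_ofNat_of_zero_le hK
      have h2 := hlim.mul ((tendsto_qParam_atImInfty hm).pow d)
      have h3 : Tendsto Φ atImInfty (𝓝 (C * 0 ^ d)) := by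
        refine h2.congr fun τ ↦ ?_
        have hq : Function.Periodic.qParam m (τ : ℂ) ≠ 0 := Function.Periodic.qParam_ne_zero _
        rw [hd, mul_assoc, ← zpow_natCast, ← zpow_add₀ hq]
        simp
      have h4 : ‖C * 0 ^ d‖ < ‖C‖ + 1 := by
        rcases eq_or_ne d 0 with rfl | hd0
        · simp
        · simp [hd0]; positivity
      exact (h3.norm.eventually_lt_const h4).mono fun _ h ↦ h.le
    obtain ⟨A, hA⟩ := (atImInfty_mem _).mp h1
    refine isBoundedAtImInfty_iff.mpr ⟨‖C‖ + 1, A + 1, fun τ hτ ↦ ?_⟩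
    refine le_of_tendsto (hlimΨ τ).norm ?_
    have h5 : ∀ᶠ z in 𝓝[≠] (τ : ℂ), A < z.im ∧ 0 < z.im := by
      refine nhdsWithin_le_nhds (((isOpen_lt continuous_const Complex.continuous_im).inter
        isOpen_upperHalfPlaneSet).mem_nhds ⟨?_, τ.im_pos⟩)
      simp only [Set.mem_ofPred_eq, coe_im]
      linarith
    filter_upwards [h5] with z ⟨hz, hz'⟩
    refine hA _ ?_
    rw [ofComplex_apply_of_im_pos hz']
    exact hz.le
  let f : ModularForm 𝒮ℒ 0 :=
    { toFun := fun τ ↦ Ψ τ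
      slash_action_eq' := by
        rintro _ ⟨γ, rfl⟩
        ext τ
        change ((fun τ : ℍ ↦ Ψ τ) ∣[(0 : ℤ)] γ) τ = _
        rw [ModularForm.SL_slash_apply]
        simpa using hinvΨ γ τ
      holo' := by
        refine UpperHalfPlane.mdifferentiable_iff.mpr fun z hz ↦ ?_
        refine (DifferentiableAt.congr_of_eventuallyEq
          (han ⟨z, hz⟩).differentiableAt ?_).differentiableWithinAt
        have : ∀ᶠ w in 𝓝 z, 0 < w.im := isOpen_upperHalfPlaneSet.mem_nhds hz
        filter_upwards [this] with w hw
        simp [ofComplex_apply_of_im_pos hw]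
      bdd_at_cusps' := by
        intro c hc
        rw [OnePoint.isBoundedAt_iff_forall_SL2Z
          ((Subgroup.IsArithmetic.isCusp_iff_isCusp_SL2Z 𝒮ℒ).mp hc)]
        intro γ _
        have : ((fun τ : ℍ ↦ Ψ τ) ∣[(0 : ℤ)] γ) = fun τ : ℍ ↦ Ψ τ := by
          ext τ
          rw [ModularForm.SL_slash_apply]
          simpa using hinvΨ γ τ
        rw [this]
        exact hbdd }
  obtain ⟨c, hc⟩ := ModularFormClass.levelOne_weight_zero_const f
  have hcΨ (τ : ℍ) : Ψ τ = c := congrFun hc τ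
  have hc0 : c ≠ 0 := hcΨ I ▸ hne I
  have hfreq : ∃ᶠ τ in atImInfty, Φ τ = c := by
    intro hev
    obtain ⟨A, hA⟩ := (atImInfty_mem _).mp hev
    set τ : ℍ := ⟨(|A| + 1 : ℝ) * Complex.I, by simp; positivity⟩ with hτ
    have h1 : ∀ᶠ z in 𝓝[≠] (τ : ℂ), A < z.im ∧ 0 < z.im := by
      refine nhdsWithin_le_nhds (((isOpen_lt continuous_const Complex.continuous_im).inter
        isOpen_upperHalfPlaneSet).mem_nhds ⟨?_, τ.im_pos⟩)
      have := le_abs_self A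
      simp [hτ]
      linarith
    obtain ⟨z, ⟨hz, hz'⟩, h2⟩ := (h1.and (heq τ)).exists
    refine hA ⟨z, hz'⟩ hz.le ?_
    rw [← hcΨ ⟨z, hz'⟩]
    simpa [ofComplex_apply_of_im_pos hz'] using h2.symm
  by_contra hK0
  have hpos : 0 < K := lt_of_le_of_ne hK (Ne.symm hK0)
  obtain ⟨d, hd⟩ := Int.eq_ofNat_of_zero_le hK
  have h2 := hlim.mul ((tendsto_qParam_atImInfty hm).pow d)
  have h3 : Tendsto Φ atImInfty (𝓝 (C * 0 ^ d)) := by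
    refine h2.congr fun τ ↦ ?_
    have hq : Function.Periodic.qParam m (τ : ℂ) ≠ 0 := Function.Periodic.qParam_ne_zero _
    rw [hd, mul_assoc, ← zpow_natCast, ← zpow_add₀ hq]
    simp
  rw [zero_pow (by rintro rfl; simp_all), mul_zero] at h3
  exact hc0 (eq_of_tendsto_of_frequently_eq h3 tendsto_const_nhds hfreq).symm

/-- A meromorphic modular function of level one without zeros and poles in the upper half-plane
has order zero at the cusp. -/
theorem exponent_eq_zero {m : ℕ} (hm : 0 < m) {Φ : ℍ → ℂ} {K : ℤ} {C : ℂ}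
    (hinv : ∀ (γ : SL(2, ℤ)) (τ : ℍ), Φ (γ • τ) = Φ τ)
    (hmer : ∀ τ : ℍ, MeromorphicAt (Φ ∘ ofComplex) τ)
    (hord : ∀ τ : ℍ, meromorphicOrderAt (Φ ∘ ofComplex) τ = 0) (hC : C ≠ 0)
    (hlim : Tendsto (fun τ : ℍ ↦ Φ τ * Function.Periodic.qParam m τ ^ (-K)) atImInfty (𝓝 C)) :
    K = 0 := by
  rcases le_total 0 K with hK | hK
  · exact exponent_eq_zero_of_nonneg hm hinv hmer hord hC hlim hK
  · have h1 := exponent_eq_zero_of_nonneg (Φ := Φ⁻¹) (K := -K) hm (fun γ τ ↦ congrArg (·⁻¹) (hinv γ τ))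
      (fun τ ↦ (hmer τ).inv) (fun τ ↦ ?_) (inv_ne_zero hC)
      ((hlim.inv₀ hC).congr fun τ ↦ by simp [mul_comm]) (by omega)
    · omega
    · have : (Φ⁻¹ ∘ ofComplex) = (Φ ∘ ofComplex)⁻¹ := rfl
      rw [this, meromorphicOrderAt_inv, hord]
      rfl

end ModularSchwarz

namespace ModularSchwarz
open Filter Topology Manifold CongruenceSubgroup

/-! ### Orders and exponents -/

/-- The function `f` is meromorphic of order `k` at `τ`. -/
def HasOrderAt (f : ℍ → ℂ) (τ : ℍ) (k : ℤ) : Prop :=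
  MeromorphicAt (f ∘ ofComplex) τ ∧ meromorphicOrderAt (f ∘ ofComplex) τ = k

lemma HasOrderAt.mul {f g : ℍ → ℂ} {τ : ℍ} {k l : ℤ} (hf : HasOrderAt f τ k)
    (hg : HasOrderAt g τ l) : HasOrderAt (fun σ ↦ f σ * g σ) τ (k + l) :=
  ⟨hf.1.mul hg.1, by
    have := meromorphicOrderAt_mul hf.1 hg.1
    rw [hf.2, hg.2] at this
    exact_mod_cast this⟩

lemma HasOrderAt.pow {f : ℍ → ℂ} {τ : ℍ} {k : ℤ} (hf : HasOrderAt f τ k) (d : ℕ) :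
    HasOrderAt (fun σ ↦ f σ ^ d) τ (d * k) :=
  ⟨hf.1.pow d, by
    have := meromorphicOrderAt_pow hf.1 (n := d)
    rw [hf.2] at this
    exact_mod_cast this⟩

lemma HasOrderAt.inv {f : ℍ → ℂ} {τ : ℍ} {k : ℤ} (hf : HasOrderAt f τ k) :
    HasOrderAt (fun σ ↦ (f σ)⁻¹) τ (-k) :=
  ⟨hf.1.inv, by
    have := meromorphicOrderAt_inv (f := f ∘ ofComplex) (x := (τ : ℂ))
    rw [hf.2] at this
    exact_mod_cast this⟩

lemma HasOrderAt.prod {ι : Type*} {s : Finset ι} {f : ι → ℍ → ℂ} {τ : ℍ} {k : ι → ℤ}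
    (h : ∀ i ∈ s, HasOrderAt (f i) τ (k i)) :
    HasOrderAt (fun σ ↦ ∏ i ∈ s, f i σ) τ (∑ i ∈ s, k i) := by
  classical
  induction s using Finset.induction with
  | empty =>
    refine ⟨by simp [Function.comp_def], ?_⟩
    have : ((fun _ : ℍ ↦ (1 : ℂ)) ∘ ofComplex) = fun _ ↦ 1 := rfl
    simp only [Finset.prod_empty, this, Finset.sum_empty]
    exact (meromorphicOrderAt_const _ _).trans (by simp)
  | insert a s ha ih =>
    simp only [Finset.prod_insert ha, Finset.sum_insert ha]
    exact (h a (Finset.mem_insert_self a s)).mul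
      (ih fun i hi ↦ h i (Finset.mem_insert_of_mem hi))

/-- At `i∞` the function `f` behaves like a nonzero multiple of `exp (2 π i k τ / m)`. -/
def HasExponent (m : ℕ) (f : ℍ → ℂ) (k : ℤ) : Prop :=
  ∃ C : ℂ, C ≠ 0 ∧
    Tendsto (fun τ : ℍ ↦ f τ * Function.Periodic.qParam m τ ^ (-k)) atImInfty (𝓝 C)

variable {m n : ℕ} {h : ℍ → ℂ}

lemma HasExponent.mul {f g : ℍ → ℂ} {k l : ℤ} (hf : HasExponent m f k) (hg : HasExponent m g l) :
    HasExponent m (fun σ ↦ f σ * g σ) (k + l) := by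
  obtain ⟨C, hC, hCl⟩ := hf
  obtain ⟨D, hD, hDl⟩ := hg
  refine ⟨C * D, mul_ne_zero hC hD, (hCl.mul hDl).congr fun τ ↦ ?_⟩
  rw [neg_add, zpow_add₀ (Function.Periodic.qParam_ne_zero _)]
  ring

lemma HasExponent.inv {f : ℍ → ℂ} {k : ℤ} (hf : HasExponent m f k) :
    HasExponent m (fun σ ↦ (f σ)⁻¹) (-k) := by
  obtain ⟨C, hC, hCl⟩ := hf
  refine ⟨C⁻¹, inv_ne_zero hC, (hCl.inv₀ hC).congr fun τ ↦ ?_⟩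
  rw [mul_inv, ← zpow_neg]

lemma HasExponent.prod {ι : Type*} {s : Finset ι} {f : ι → ℍ → ℂ} {k : ι → ℤ}
    (h : ∀ i ∈ s, HasExponent m (f i) (k i)) :
    HasExponent m (fun σ ↦ ∏ i ∈ s, f i σ) (∑ i ∈ s, k i) := by
  classical
  induction s using Finset.induction with
  | empty => exact ⟨1, one_ne_zero, by simp⟩
  | insert a s ha ih =>
    simp only [Finset.prod_insert ha, Finset.sum_insert ha]
    exact (h a (Finset.mem_insert_self a s)).mul
      (ih fun i hi ↦ h i (Finset.mem_insert_of_mem hi))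

lemma HasExponent.pow {f : ℍ → ℂ} {k : ℤ} (hf : HasExponent m f k) (d : ℕ) :
    HasExponent m (fun σ ↦ f σ ^ d) (d * k) := by
  simpa using HasExponent.prod (s := Finset.range d) (f := fun _ ↦ f) (k := fun _ ↦ k)
    fun _ _ ↦ hf

lemma qParam_one_eq_pow (hm : 0 < m) (z : ℂ) :
    Function.Periodic.qParam 1 z = Function.Periodic.qParam m z ^ m := by
  have : (m : ℂ) ≠ 0 := by exact_mod_cast hm.ne'
  simp only [Function.Periodic.qParam, ← Complex.exp_nat_mul]
  congr 1
  push_cast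
  field_simp

lemma hasExponent_discriminant (hm : 0 < m) : HasExponent m ModularForm.discriminant m := by
  refine ⟨1, one_ne_zero, tendsto_discriminant_div_qParam.congr fun τ ↦ ?_⟩
  rw [qParam_one_eq_pow hm, zpow_neg, zpow_natCast, div_eq_mul_inv]

lemma hasExponent_jInv_sub (hm : 0 < m) (c : ℂ) : HasExponent m (fun τ ↦ jInv τ - c) (-m) := by
  refine ⟨1, one_ne_zero, ?_⟩
  have h1 := tendsto_jInv_mul_qParam.sub ((UpperHalfPlane.qParam_tendsto_atImInfty
    (h := 1) one_pos).const_mul c)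
  rw [mul_zero, sub_zero] at h1
  refine h1.congr fun τ ↦ ?_
  rw [neg_neg, zpow_natCast, ← qParam_one_eq_pow hm, sub_mul]

lemma hasOrderAt_discriminant (τ : ℍ) : HasOrderAt ModularForm.discriminant τ 0 := by
  have h1 := analyticAt_discriminant τ.im_pos
  refine ⟨h1.meromorphicAt, ?_⟩
  have := h1.meromorphicNFAt.meromorphicOrderAt_eq_zero_iff.mpr
    (by simpa using ModularForm.discriminant_ne_zero τ)
  simpa using this

lemma meromorphicAt_jInv_sub (τ : ℍ) (c : ℂ) :
    MeromorphicAt ((fun σ ↦ jInv σ - c) ∘ ofComplex) τ :=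
  (analyticAt_jInv τ.im_pos).meromorphicAt.sub (MeromorphicAt.const c _)

/-! ### Counting cosets over orbits -/

lemma mk_eq_mk_iff (x : SL(2, ℤ)) (σ τ : ℍ) :
    (Quotient.mk _ (x • τ) : MulAction.orbitRel.Quotient (Gamma m) ℍ) = Quotient.mk _ σ ↔
      ∃ N ∈ Gamma m, (N * x) • τ = σ := by
  rw [eq_comm, Quotient.eq]
  change σ ∈ MulAction.orbit (Gamma m) (x • τ) ↔ _
  constructor
  · rintro ⟨N, rfl⟩
    exact ⟨N, N.2, mul_smul _ _ _⟩
  · rintro ⟨N, hN, rfl⟩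
    have h1 : N • x • τ = (N * x) • τ := (mul_smul N x τ).symm
    exact ⟨⟨N, hN⟩, h1⟩

/-- The cosets carrying `τ` into the class of `σ` are counted by the image of the stabilizer of `τ`
modulo `Γ(m)`. Times `signCard m` this is the order of the stabilizer, twice the order of vanishing.
-/
lemma hasOrderAt_jInv_sub (hm : 2 ≤ m) (τ σ : ℍ) :
    ∃ k : ℤ, HasOrderAt (fun τ' ↦ jInv τ' - jInv σ) τ k ∧
      2 * k = signCard m * ({x : SL(2, ℤ) ⧸ Gamma m |
        (Quotient.mk _ (x.out • τ) : MulAction.orbitRel.Quotient (Gamma m) ℍ) =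
          Quotient.mk _ σ}.ncard : ℤ) := by
  by_cases hγ : ∃ γ : SL(2, ℤ), γ • τ = σ
  · obtain ⟨γ, rfl⟩ := hγ
    obtain ⟨k, hk, hord⟩ := exists_order_jInv τ
    refine ⟨k, ⟨meromorphicAt_jInv_sub _ _, by rw [jInv_smul]; exact hord⟩, ?_⟩
    have hset : {x : SL(2, ℤ) ⧸ Gamma m |
        (Quotient.mk _ (x.out • τ) : MulAction.orbitRel.Quotient (Gamma m) ℍ) =
          Quotient.mk _ (γ • τ)} =
        {x | ∃ N ∈ Gamma m, γ⁻¹ * N * x.out ∈ MulAction.stabilizer SL(2, ℤ) τ} := by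
      ext x
      simp only [Set.mem_ofPred_eq, mk_eq_mk_iff, MulAction.mem_stabilizer_iff]
      refine exists_congr fun N ↦ and_congr_right fun _ ↦ ?_
      rw [mul_assoc, mul_smul γ⁻¹, inv_smul_eq_iff]
    rw [hset, ncard_cosets]
    have := signCard_mul_card_map_stabilizer hm τ
    exact_mod_cast hk.trans this.symm
  · refine ⟨0, ⟨meromorphicAt_jInv_sub _ _, order_jInv_eq_zero fun γ hg ↦ hγ ⟨γ, hg⟩⟩, ?_⟩
    have hset : {x : SL(2, ℤ) ⧸ Gamma m |
        (Quotient.mk _ (x.out • τ) : MulAction.orbitRel.Quotient (Gamma m) ℍ) =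
          Quotient.mk _ σ} = ∅ := by
      refine Set.eq_empty_of_forall_notMem fun x hx ↦ hγ ?_
      obtain ⟨N, -, hN⟩ := (mk_eq_mk_iff _ _ _).mp hx
      exact ⟨_, hN⟩
    rw [hset]
    simp

lemma mk_mem_interiorPoles (hmod : IsModularFunction m h) (τ : ℍ) :
    (Quotient.mk _ τ : MulAction.orbitRel.Quotient (Gamma m) ℍ) ∈ interiorPoles m h ↔
      HasPoleAt h τ := by
  constructor
  · rintro ⟨σ, hσ, he⟩
    have h1 := (mk_eq_mk_iff (m := m) 1 σ τ).mp (by rw [one_smul]; exact he)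
    obtain ⟨N, hN, rfl⟩ := h1
    rw [mul_one] at hσ
    exact (hasPoleAt_smul_of_mem hmod hN τ).mp hσ
  · exact fun hp ↦ ⟨τ, hp, rfl⟩

lemma ncard_hasPoleAt_smul [Finite (SL(2, ℤ) ⧸ Gamma m)] (hmod : IsModularFunction m h)
    (hfin : (interiorPoles m h).Finite) (τ : ℍ) :
    {x : SL(2, ℤ) ⧸ Gamma m | HasPoleAt h (x.out • τ)}.ncard =
      ∑ q ∈ hfin.toFinset, {x : SL(2, ℤ) ⧸ Gamma m |
        (Quotient.mk _ (x.out • τ) : MulAction.orbitRel.Quotient (Gamma m) ℍ) = q}.ncard := by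
  classical
  have := Fintype.ofFinite (SL(2, ℤ) ⧸ Gamma m)
  simp only [Set.ncard_eq_toFinset_card']
  rw [Finset.card_eq_sum_card_fiberwise (t := hfin.toFinset)
    (f := fun x ↦ (Quotient.mk _ (x.out • τ) : MulAction.orbitRel.Quotient (Gamma m) ℍ))]
  · refine Finset.sum_congr rfl fun q hq ↦ congrArg _ ?_
    ext x
    simp only [Finset.mem_filter, Set.mem_toFinset, Set.mem_ofPred_eq, and_iff_right_iff_imp]
    rintro rfl
    exact (mk_mem_interiorPoles hmod _).mp (hfin.mem_toFinset.mp hq)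
  · intro x hx
    have hx' : HasPoleAt h (x.out • τ) := by
      simpa only [Finset.mem_coe, Set.mem_toFinset, Set.mem_ofPred_eq] using hx
    exact hfin.mem_toFinset.mpr ((mk_mem_interiorPoles hmod _).mpr hx')

/-! ### Counting cosets over cusps -/

/-- The class of the cusp `γ ∞`. -/
noncomputable def cuspClass (m : ℕ) [NeZero m] (γ : SL(2, ℤ)) :
    CuspOrbits (Gamma m : Subgroup (GL (Fin 2) ℝ)) :=
  Quotient.mk _ ⟨Matrix.SpecialLinearGroup.mapGL ℝ γ • OnePoint.infty,
    (Subgroup.IsArithmetic.isCusp_iff_isCusp_SL2Z _).mpr (isCusp_SL2Z_iff'.mpr ⟨γ, rfl⟩)⟩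

lemma cuspClass_eq_iff [NeZero m] (γ γ' : SL(2, ℤ)) :
    cuspClass m γ = cuspClass m γ' ↔ ∃ N ∈ Gamma m, γ'⁻¹ * N * γ ∈ stabilizerInfty := by
  rw [eq_comm, cuspClass, cuspClass, Quotient.eq]
  have key (N : SL(2, ℤ)) : Matrix.SpecialLinearGroup.mapGL ℝ N •
      Matrix.SpecialLinearGroup.mapGL ℝ γ • (OnePoint.infty : OnePoint ℝ) =
      Matrix.SpecialLinearGroup.mapGL ℝ γ' • (OnePoint.infty : OnePoint ℝ) ↔
      γ'⁻¹ * N * γ ∈ stabilizerInfty := by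
    rw [← mul_smul, ← map_mul, mapGL_smul_infty_eq_iff, mul_assoc]
  constructor
  · rintro ⟨⟨_, N, hN, rfl⟩, he⟩
    exact ⟨N, hN, (key N).mp (congrArg Subtype.val he)⟩
  · rintro ⟨N, hN, he⟩
    exact ⟨⟨_, N, hN, rfl⟩, Subtype.ext ((key N).mpr he)⟩

lemma cuspClass_surjective [NeZero m] : Function.Surjective (cuspClass m) := by
  rintro ⟨c, hc⟩
  obtain ⟨γ, rfl⟩ := isCusp_SL2Z_iff'.mp ((Subgroup.IsArithmetic.isCusp_iff_isCusp_SL2Z _).mp hc)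
  exact ⟨γ, rfl⟩

/-- Normality of `Γ(m)` makes the count the same over every cusp. -/
lemma ncard_cuspClass_eq [NeZero m] (c : CuspOrbits (Gamma m : Subgroup (GL (Fin 2) ℝ))) :
    {x : SL(2, ℤ) ⧸ Gamma m | cuspClass m x.out = c}.ncard =
      Nat.card (stabilizerInfty.map (QuotientGroup.mk' (Gamma m))) := by
  obtain ⟨γ, rfl⟩ := cuspClass_surjective c
  simp only [cuspClass_eq_iff]
  exact ncard_cosets _ _ _

/-- The exclusion of the class of `∞` in `cuspPoles` costs nothing, as `hinfty` rules out a pole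
there. -/
lemma cuspClass_mem_cuspPoles [NeZero m] (hn : 0 < n) (hmod : IsModularFunction m h)
    (hsol : IsSchwarzSolution m n h) (hinfty : ¬ HasPoleAtCusp m h OnePoint.infty)
    (γ : SL(2, ℤ)) :
    cuspClass m γ ∈ cuspPoles m h ↔ meromorphicOrderAt (cuspExpansion m h γ) 0 < 0 := by
  have hm : 0 < m := NeZero.pos m
  have key (N γ' : SL(2, ℤ)) (hN : N ∈ Gamma m)
      (he : Matrix.SpecialLinearGroup.mapGL ℝ N •
        Matrix.SpecialLinearGroup.mapGL ℝ γ' • (OnePoint.infty : OnePoint ℝ) =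
        Matrix.SpecialLinearGroup.mapGL ℝ γ • (OnePoint.infty : OnePoint ℝ)) :
      meromorphicOrderAt (cuspExpansion m h γ) 0 < 0 ↔
        meromorphicOrderAt (cuspExpansion m h γ') 0 < 0 := by
    rw [← hasPoleAtCusp_iff hm hn hmod hsol, ← he, ← mul_smul, ← map_mul,
      hasPoleAtCusp_iff hm hn hmod hsol, cuspExpansion_mul_left hmod hN]
  constructor
  · rintro ⟨⟨c, hc⟩, he, hp, -⟩
    obtain ⟨γ', rfl⟩ := isCusp_SL2Z_iff'.mp ((Subgroup.IsArithmetic.isCusp_iff_isCusp_SL2Z _).mp hc)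
    obtain ⟨⟨_, N, hN, rfl⟩, he'⟩ := Quotient.exact he
    exact (key N γ' hN (congrArg Subtype.val he')).mpr ((hasPoleAtCusp_iff hm hn hmod hsol _).mp hp)
  · intro hp
    refine ⟨_, rfl, (hasPoleAtCusp_iff hm hn hmod hsol _).mpr hp, ?_⟩
    rintro _ ⟨N, hN, rfl⟩ he
    refine hinfty ?_
    have h1 := (key N 1 hN (by simpa using he)).mp hp
    simpa using (hasPoleAtCusp_iff hm hn hmod hsol 1).mpr h1

lemma ncard_pole_cuspExpansion [NeZero m] (hn : 0 < n) (hmod : IsModularFunction m h)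
    (hsol : IsSchwarzSolution m n h) (hinfty : ¬ HasPoleAtCusp m h OnePoint.infty) :
    {x : SL(2, ℤ) ⧸ Gamma m | meromorphicOrderAt (cuspExpansion m h x.out) 0 < 0}.ncard =
      (cuspPoles m h).ncard * Nat.card (stabilizerInfty.map (QuotientGroup.mk' (Gamma m))) := by
  classical
  have : Finite (SL(2, ℤ) ⧸ Gamma m) := Subgroup.finite_quotient_of_finiteIndex
  have := Fintype.ofFinite (SL(2, ℤ) ⧸ Gamma m)
  have hfin : (cuspPoles m h).Finite := finite_cuspPoles (NeZero.pos m)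
  have hfib := fun c ↦ ncard_cuspClass_eq (m := m) c
  rw [Set.ncard_eq_toFinset_card _ hfin, ← smul_eq_mul, ← Finset.sum_const]
  simp only [Set.ncard_eq_toFinset_card'] at hfib ⊢
  rw [Finset.card_eq_sum_card_fiberwise (t := hfin.toFinset) (f := fun x ↦ cuspClass m x.out)]
  · refine Finset.sum_congr rfl fun c hc ↦ ?_
    rw [← hfib c]
    congr 1
    ext x
    simp only [Finset.mem_filter, Set.mem_toFinset, Set.mem_ofPred_eq, and_iff_right_iff_imp]
    rintro rfl
    exact (cuspClass_mem_cuspPoles hn hmod hsol hinfty _).mp (hfin.mem_toFinset.mp hc)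
  · intro x hx
    simpa [cuspClass_mem_cuspPoles hn hmod hsol hinfty] using hx

/-! ### The weight zero form attached to a solution -/

/-- The product of the `D_x ^ 6 / Δ`, for `x` in `SL(2, ℤ) / Γ(m)`, where `D_x` is the derivative
of the translate of `h` by `x`. -/
noncomputable def derivProduct (m : ℕ) [Fintype (SL(2, ℤ) ⧸ Gamma m)] (h : ℍ → ℂ) (τ : ℍ) : ℂ :=
  ∏ x : SL(2, ℤ) ⧸ Gamma m, translateDeriv h x.out τ ^ 6 * (ModularForm.discriminant τ)⁻¹

lemma translateDeriv_congr (hmod : IsModularFunction m h) {γ γ' : SL(2, ℤ)}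
    (he : (γ : SL(2, ℤ) ⧸ Gamma m) = γ') : translateDeriv h γ = translateDeriv h γ' := by
  have h1 := QuotientGroup.eq.mp he
  have h2 := hmod.smul_mul_right h1 γ
  rw [mul_inv_cancel_left] at h2
  ext τ
  rw [translateDeriv, translateDeriv, h2]

/-- `γ` permutes the cosets by right multiplication, and the weight 12 of `D_x ^ 6` is cancelled by
`Δ`. -/
lemma derivProduct_smul [Fintype (SL(2, ℤ) ⧸ Gamma m)] (hmod : IsModularFunction m h)
    (γ : SL(2, ℤ)) (τ : ℍ) : derivProduct m h (γ • τ) = derivProduct m h τ := by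
  rw [derivProduct, derivProduct,
    ← Equiv.prod_comp (Equiv.mulRight (γ : SL(2, ℤ) ⧸ Gamma m))
      (fun x ↦ translateDeriv h x.out τ ^ 6 * (ModularForm.discriminant τ)⁻¹)]
  refine Finset.prod_congr rfl fun x _ ↦ ?_
  have h1 : translateDeriv h (x.out * γ) = translateDeriv h (Equiv.mulRight
      (γ : SL(2, ℤ) ⧸ Gamma m) x).out := by
    refine translateDeriv_congr hmod ?_
    rw [QuotientGroup.mk_mul, QuotientGroup.out_eq', QuotientGroup.out_eq', Equiv.coe_mulRight]
  rw [translateDeriv_smul, discriminant_smul, h1]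
  have h2 := denom_ne_zero γ τ
  have h3 := ModularForm.discriminant_ne_zero τ
  field_simp

end ModularSchwarz

namespace ModularSchwarz
open Filter Topology Manifold CongruenceSubgroup

/-! ### The valence formula -/

variable {m n : ℕ} {h : ℍ → ℂ}

/-- The valence formula for a solution of the Schwarzian equation. -/
theorem valence_formula (hm : 2 ≤ m) (hn : 0 < n) (hmod : IsModularFunction m h)
    (hsol : IsSchwarzSolution m n h) (hinfty : ¬ HasPoleAtCusp m h OnePoint.infty) :
    (signCard m : ℤ) * (6 * n * (Nat.card (SL(2, ℤ) ⧸ Gamma m) -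
      2 * ((cuspPoles m h).ncard * Nat.card (stabilizerInfty.map (QuotientGroup.mk' (Gamma m))) : ℕ))
      - m * Nat.card (SL(2, ℤ) ⧸ Gamma m)) = 24 * m * (interiorPoles m h).ncard := by
  classical
  have hm0 : 0 < m := by omega
  have : NeZero m := ⟨hm0.ne'⟩
  have : Finite (SL(2, ℤ) ⧸ Gamma m) := Subgroup.finite_quotient_of_finiteIndex
  have := Fintype.ofFinite (SL(2, ℤ) ⧸ Gamma m)
  have hfin := finite_interiorPoles hm0 hmod
  -- Each coset with a pole at `x • τ` contributes `-12` to the order of `derivProduct`. By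
  -- `hasOrderAt_jInv_sub`, `signCard m` times the number of such cosets is twice the sum of the
  -- orders of the `jInv - jInv q.out`, whence the exponents `signCard m` and `24`.
  set Φ : ℍ → ℂ := fun τ ↦ derivProduct m h τ ^ signCard m *
    ∏ q ∈ hfin.toFinset, (jInv τ - jInv q.out) ^ 24 with hΦ
  have hinv (γ : SL(2, ℤ)) (τ : ℍ) : Φ (γ • τ) = Φ τ := by
    simp only [hΦ, derivProduct_smul hmod, jInv_smul]
  have hord (τ : ℍ) : HasOrderAt Φ τ 0 := by
    have h1 : HasOrderAt (derivProduct m h) τ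
        (∑ x : SL(2, ℤ) ⧸ Gamma m,
          ((6 : ℕ) * (if HasPoleAt h (x.out • τ) then -2 else 0) + -0)) :=
      HasOrderAt.prod fun x _ ↦ (HasOrderAt.pow ⟨?_, order_translateDeriv hm0 hn hmod hsol _ τ⟩ 6).mul
        (hasOrderAt_discriminant τ).inv
    · choose k hk hk2 using fun q : MulAction.orbitRel.Quotient (Gamma m) ℍ ↦
        hasOrderAt_jInv_sub hm τ q.out
      have h2 : HasOrderAt (fun τ ↦ ∏ q ∈ hfin.toFinset, (jInv τ - jInv q.out) ^ 24) τ
          (∑ q ∈ hfin.toFinset, (24 : ℕ) * k q) :=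
        HasOrderAt.prod fun q _ ↦ (hk q).pow 24
      have h3 := (h1.pow (signCard m)).mul h2
      have h4 : (signCard m : ℤ) * (∑ x : SL(2, ℤ) ⧸ Gamma m,
          (((6 : ℕ) : ℤ) * (if HasPoleAt h (x.out • τ) then -2 else 0) + -0)) +
          ∑ q ∈ hfin.toFinset, ((24 : ℕ) : ℤ) * k q = 0 := by
        have h5 := ncard_hasPoleAt_smul hmod hfin τ
        have h6 : ∑ x : SL(2, ℤ) ⧸ Gamma m,
            (((6 : ℕ) : ℤ) * (if HasPoleAt h (x.out • τ) then -2 else 0) + -0) =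
            -12 * ({x : SL(2, ℤ) ⧸ Gamma m | HasPoleAt h (x.out • τ)}.ncard : ℤ) := by
          rw [Set.ncard_eq_toFinset_card', Set.toFinset_ofPred, Finset.card_filter]
          push_cast
          rw [Finset.mul_sum]
          refine Finset.sum_congr rfl fun x _ ↦ ?_
          split_ifs <;> simp
        have h7 (q : MulAction.orbitRel.Quotient (Gamma m) ℍ) := (hk2 q).trans (by
          rw [show (Quotient.mk _ q.out : MulAction.orbitRel.Quotient (Gamma m) ℍ) = q from
            Quotient.out_eq q])
        rw [h6, h5]
        push_cast
        rw [← Finset.mul_sum, mul_left_comm, Finset.mul_sum, ← Finset.sum_congr rfl fun q _ ↦ h7 q,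
          ← Finset.mul_sum]
        ring
      rw [h4] at h3
      exact h3
    · have := hmod.meromorphicAt_translate x.out τ
      refine this.deriv.congr ?_
      have h2 : ∀ᶠ z in 𝓝[≠] (τ : ℂ), 0 < z.im :=
        nhdsWithin_le_nhds (isOpen_upperHalfPlaneSet.mem_nhds τ.im_pos)
      filter_upwards [h2] with z hz
      simp [translateDeriv, ofComplex_apply_of_im_pos hz]
  -- At `i∞` each coset gives `±6n` from the derivative and `-m` from `1 / Δ`, and each interior
  -- pole gives `-24m`.
  have hexp : HasExponent m Φ (signCard m * (∑ x : SL(2, ℤ) ⧸ Gamma m,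
      ((6 : ℕ) * (if meromorphicOrderAt (cuspExpansion m h x.out) 0 < 0 then -(n : ℤ) else n) +
        -(m : ℤ))) + ∑ q ∈ hfin.toFinset, (24 : ℕ) * (-(m : ℤ))) := by
    refine HasExponent.mul (HasExponent.pow (HasExponent.prod fun x _ ↦ ?_) _)
      (HasExponent.prod fun q _ ↦ (hasExponent_jInv_sub hm0 _).pow 24)
    exact (HasExponent.pow (exists_cusp_asymptotics hm0 hn hmod hsol x.out) 6).mul
      (hasExponent_discriminant hm0).inv
  obtain ⟨C, hC, hlim⟩ := hexp
  have hK := exponent_eq_zero hm0 hinv (fun τ ↦ (hord τ).1) (fun τ ↦ by simpa using (hord τ).2)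
    hC hlim
  have hB := ncard_pole_cuspExpansion hn hmod hsol hinfty
  have h6 : ∑ x : SL(2, ℤ) ⧸ Gamma m,
      (((6 : ℕ) : ℤ) * (if meromorphicOrderAt (cuspExpansion m h x.out) 0 < 0 then -(n : ℤ) else n) +
        -(m : ℤ)) = 6 * n * (Nat.card (SL(2, ℤ) ⧸ Gamma m) - 2 * ({x : SL(2, ℤ) ⧸ Gamma m |
          meromorphicOrderAt (cuspExpansion m h x.out) 0 < 0}.ncard : ℤ)) -
          m * Nat.card (SL(2, ℤ) ⧸ Gamma m) := by
    have h7 : ∀ x : SL(2, ℤ) ⧸ Gamma m, (((6 : ℕ) : ℤ) *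
        (if meromorphicOrderAt (cuspExpansion m h x.out) 0 < 0 then -(n : ℤ) else n) + -(m : ℤ)) =
        (6 * n - m : ℤ) - 12 * n *
        (if meromorphicOrderAt (cuspExpansion m h x.out) 0 < 0 then 1 else 0) := by
      intro x
      split_ifs <;> push_cast <;> ring
    rw [Finset.sum_congr rfl fun x _ ↦ h7 x, Finset.sum_sub_distrib, ← Finset.mul_sum,
      Finset.sum_boole, Finset.sum_const, Finset.card_univ, Set.ncard_eq_toFinset_card',
      Set.toFinset_ofPred, Nat.card_eq_fintype_card, nsmul_eq_mul]
    ring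
  rw [h6, hB, Finset.sum_const, ← Set.ncard_eq_toFinset_card _ hfin, nsmul_eq_mul] at hK
  push_cast at hK ⊢
  linarith

end ModularSchwarz

/-! ### Solving the valence formula at levels 2 to 5 -/

theorem proposition4p1 (m n : ℕ) (hm2 : 2 ≤ m) (hm5 : m ≤ 5) (hn : 0 < n) (h : UpperHalfPlane → ℂ)
    (hmod : ModularSchwarz.IsModularFunction m h)
    (hsol : ModularSchwarz.IsSchwarzSolution m n h)
    (hinfty : ¬ ModularSchwarz.HasPoleAtCusp m h OnePoint.infty)
    (a b : ℕ)
    (ha : a = (ModularSchwarz.interiorPoles m h).ncard)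
    (hb : b = (ModularSchwarz.cuspPoles m h).ncard) :
    (ModularSchwarz.interiorPoles m h).Finite ∧ (ModularSchwarz.cuspPoles m h).Finite ∧
    (m = 2 → ((a : ℚ), (b : ℚ)) ∈
      ({((3 * (n : ℚ) - 1) / 2, 0), (((n : ℚ) - 1) / 2, 1)} : Set (ℚ × ℚ))) ∧
    (m = 3 → ((a : ℤ), (b : ℤ)) ∈
      ({(2 * (n : ℤ) - 1, 0), ((n : ℤ) - 1, 1)} : Set (ℤ × ℤ))) ∧
    (m = 4 → ((a : ℤ), (b : ℤ)) ∈
      ({(3 * (n : ℤ) - 2, 0), (2 * (n : ℤ) - 2, 1), ((n : ℤ) - 2, 2)} : Set (ℤ × ℤ))) ∧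
    (m = 5 → ∃ k : ℤ, 0 ≤ k ∧ k ≤ 5 ∧
      ((a : ℤ), (b : ℤ)) = ((n : ℤ) * (6 - k) - 5, k)) := by
  have hv := ModularSchwarz.valence_formula hm2 hn hmod hsol hinfty
  rw [← ha, ← hb] at hv
  -- For `m = 3, 4, 5` the formula reads `n (B - b) = a + c` with `c > 0`, which bounds `b`.
  have hb_lt (B c : ℕ) (hB : (n : ℤ) * (B - b) = a + c) (hc : 0 < c) : b < B := by
    by_contra hge
    have : (n : ℤ) * (B - b) ≤ 0 :=
      mul_nonpos_of_nonneg_of_nonpos (by positivity) (by omega)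
    omega
  refine ⟨ModularSchwarz.finite_interiorPoles (by omega) hmod, ModularSchwarz.finite_cuspPoles (by omega), ?_, ?_, ?_, ?_⟩
  · rintro rfl
    obtain ⟨h1, h2, h3⟩ := ModularSchwarz.group_data_two
    rw [h1, h2, h3] at hv
    push_cast at hv
    have h4 : 2 * (a : ℤ) = 3 * n - 1 - 2 * (n * b) := by linarith
    have hb2 : b < 2 := by
      by_contra hge
      have : (n : ℤ) * 2 ≤ n * b := by
        have : (2 : ℤ) ≤ b := by omega
        gcongr
      omega
    have h5 : 2 * (a : ℚ) = 3 * n - 1 - 2 * (n * b) := by exact_mod_cast h4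
    simp only [Set.mem_insert_iff, Set.mem_singleton_iff, Prod.mk.injEq]
    interval_cases b
    · left
      constructor
      · push_cast at h5; linarith
      · simp
    · right
      constructor
      · push_cast at h5; linarith
      · simp
  · rintro rfl
    obtain ⟨h1, h2, h3⟩ := ModularSchwarz.group_data_three
    rw [h1, h2, h3] at hv
    push_cast at hv
    have h4 : (a : ℤ) = 2 * n - 1 - n * b := by linarith
    have hb2 : b < 2 := hb_lt 2 1 (by push_cast; linarith) (by norm_num)
    simp only [Set.mem_insert_iff, Set.mem_singleton_iff, Prod.mk.injEq]
    clear hv ha hb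
    interval_cases b <;> simp at h4 ⊢ <;> omega
  · rintro rfl
    obtain ⟨h1, h2, h3⟩ := ModularSchwarz.group_data_four
    rw [h1, h2, h3] at hv
    push_cast at hv
    have h4 : (a : ℤ) = 3 * n - 2 - n * b := by linarith
    have hb2 : b < 3 := hb_lt 3 2 (by push_cast; linarith) (by norm_num)
    simp only [Set.mem_insert_iff, Set.mem_singleton_iff, Prod.mk.injEq]
    clear hv ha hb
    interval_cases b <;> simp at h4 ⊢ <;> omega
  · rintro rfl
    obtain ⟨h1, h2, h3⟩ := ModularSchwarz.group_data_five
    rw [h1, h2, h3] at hv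
    push_cast at hv
    have hb2 : b < 6 := hb_lt 6 5 (by push_cast; linarith) (by norm_num)
    refine ⟨b, by positivity, by omega, ?_⟩
    simp only [Prod.mk.injEq, and_true]
    linarith
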